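/- Let $d\ge 1$, $a<b$, $r\in\mathbb{R}\setminus\{0\}$, and let $P,Q$ be real symmetric nonsingular $d\times d$ matrices such that $-P^{-1}Q=\Omega^2$ for some real matrix $\Omega$ that is diagonalizable over $\mathbb{R}$. Suppose that for every eigenvalue $\omega$ of $\Omega$ $$\frac{(b-a)\omega}{\pi}\notin\mathbb{Q}\qquad\text{and}\qquad \frac1\pi\arccos\Bigl(1-\frac{(b-a)^2\omega^2}{2r^2n^2}\Bigr)\notin\mathbb{Q}$$ for every integer $n\ge1$ for which the argument of the arccosine lies in $[-1,1]$ (for other $n$ the arccosine is not real). For the lagrangian $\frac12{}^t\dot{\mathbf x}P\dot{\mathbf x}+\frac12{}^t\mathbf xQ\mathbf x$ the classical Euler--Lagrange equation on $[a,b]$ is $-P\ddot{\mathbf z}+Q\mathbf z=0$. For $\varepsilon>0$ let $$(\Box_\varepsilon\mathbf x)(t)=\frac r\varepsilon\bigl(\chi_{-1}(t)\mathbf x(t+\varepsilon)-\chi_{1}(t)\mathbf x(t-\varepsilon)\bigr),\qquad (\Box_{-\varepsilon}\mathbf x)(t)=\frac r\varepsilon\bigl(\chi_{1}(t)\mathbf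 x(t-\varepsilon)-\chi_{-1}(t)\mathbf x(t+\varepsilon)\bigr),$$ where $\chi_{i}$ is the indicator function of $[\max(a,a+i\varepsilon),\min(b,b+i\varepsilon)]$. The discrete Euler--Lagrange equation at the time $t$ is $\Box_{-\varepsilon}(P\Box_\varepsilon\mathbf x)(t)+Q\mathbf x(t)=0$. A function $\mathbf y:[a,b]\to\mathbb{C}^d$ is called a pseudo-periodic discrete solution if it satisfies this equation for all $t\in[a+2\varepsilon,b-2\varepsilon]$ and is a finite sum $$\mathbf y(t)=\sum_\theta \exp\Bigl(i\theta\,\frac{t-a}{2\varepsilon}\Bigr)\mathbf w_\theta,\qquad \mathbf w_\theta\in\mathbb{C}^d,$$ over real $\theta\in(-\pi,\pi]$ such that $e^{i\theta}$ is an eigenvalue of the companion matrix $\begin{pmatrix}2I_d+\frac{\varepsilon^2}{r^2}P^{-1}Q&-I_d\\ I_d&0\end{pmatrix}$ of the recurrence that the discrete equation imposes on $\mathbf u_n=\mathbf x(a+2n\varepsilon)$. Then: 1. For all $\mathbf d_a,\mathbf d_b\in\mathbb{C}^d$ the classical equation has exactly one solution $\mathbf z$ on $[a,b]$ with $\mathbf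 z(a)=\mathbf d_a$, $\mathbf z(b)=\mathbf d_b$. 2. For every $\varepsilon=(b-a)/M$ with $M\ge 6$ even and $\varepsilon|\omega|<2|r|$ for all eigenvalues $\omega$ of $\Omega$, and for all $\mathbf d_a,\mathbf d_b\in\mathbb{C}^d$, there is exactly one pseudo-periodic discrete solution $\mathbf y_\varepsilon$ on $[a,b]$ with $\mathbf y_\varepsilon(a)=\mathbf d_a$ and $\mathbf y_\varepsilon(b)=\mathbf d_b$. 3. $r=\pm\frac12$ if and only if for all $\mathbf d_a,\mathbf d_b\in\mathbb{C}^d$, $\mathbf y_\varepsilon\to\mathbf z$ uniformly on $[a,b]$ as $\varepsilon=(b-a)/M\to0$ ($M$ even). Statements 2 and 3 also hold if the conditions $\mathbf y_\varepsilon(a)=\mathbf d_a$, $\mathbf y_\varepsilon(b)=\mathbf d_b$ are replaced by the values at $a+2\varepsilon$ and $b-2\varepsilon$ that the discrete equation at $t=a$ and $t=b$ forces from the Dirichlet data, that is, by the requirement that $\mathbf y_\varepsilon$ agrees on $[a+2\varepsilon,b-2\varepsilon]$ with some $\mathbf x$ such that $\mathbf x(a)=\mathbf d_a$, $\mathbf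 x(b)=\mathbf d_b$ and $\mathbf x$ satisfies the discrete equation at $t=a$ and at $t=b$. -/

import Mathlib

namespace DiscreteEL

/-- The characteristic function of the interval `[max(a, a + iε), min(b, b + iε)]`. -/
noncomputable def chi (a b ε : ℝ) (i : ℤ) (t : ℝ) : ℂ :=
  Set.indicator (Set.Icc (max a (a + i * ε)) (min b (b + i * ε))) (fun _ => (1 : ℂ)) t

/-- The scale derivative with `2N+1` terms,
`(□_ε x)(t) = ∑_{i=-N}^{N} c_i χ_{-i}(t) x(t + iε)`.
The operator `□_{-ε}` is obtained by changing the sign of `ε` with the coefficients `c_i` kept,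
that is `(□_{-ε} x)(t) = ∑ c_i χ_i(t) x(t - iε)`. -/
noncomputable def box {d : ℕ} (a b : ℝ) (N : ℕ) (c : ℤ → ℂ) (ε : ℝ)
    (x : ℝ → Fin d → ℂ) (t : ℝ) : Fin d → ℂ :=
  ∑ i ∈ Finset.Icc (-(N : ℤ)) (N : ℤ), (c i * chi a b ε (-i) t) • x (t + i * ε)

/-- Coefficients of the three-term operator `□_ε^{[r,s]}`:
`c_{-1} = -s/ε`, `c_0 = (s-r)/ε`, `c_1 = r/ε`. -/
noncomputable def rsCoeff (r s : ℂ) (ε : ℝ) (i : ℤ) : ℂ :=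
  if i = -1 then -s / ε else if i = 0 then (s - r) / ε else if i = 1 then r / ε else 0

/-- A real matrix seen as a complex matrix. -/
noncomputable def toC {d : ℕ} (A : Matrix (Fin d) (Fin d) ℝ) : Matrix (Fin d) (Fin d) ℂ :=
  A.map (fun u : ℝ => (u : ℂ))

/-- `Ω` is diagonalizable over `ℝ`. -/
def IsDiagonalizable {d : ℕ} (Ω : Matrix (Fin d) (Fin d) ℝ) : Prop :=
  ∃ (B : Matrix (Fin d) (Fin d) ℝ) (D : Fin d → ℝ),
    IsUnit B.det ∧ B⁻¹ * Ω * B = Matrix.diagonal D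

/-- `z` is a twice differentiable solution on `[a,b]` of the classical Euler-Lagrange equation
`-P z'' + Q z = 0` of the lagrangian `½ ᵗẋPẋ + ½ ᵗxQx`, with `z(a) = da` and `z(b) = db`. -/
def IsCELSolution {d : ℕ} (P Q : Matrix (Fin d) (Fin d) ℝ) (a b : ℝ) (da db : Fin d → ℂ)
    (z : ℝ → Fin d → ℂ) : Prop :=
  z a = da ∧ z b = db ∧
    ∃ z₁ z₂ : ℝ → Fin d → ℂ, ∀ t ∈ Set.Icc a b,
      HasDerivWithinAt z (z₁ t) (Set.Icc a b) t ∧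
      HasDerivWithinAt z₁ (z₂ t) (Set.Icc a b) t ∧
      -((toC P).mulVec (z₂ t)) + (toC Q).mulVec (z t) = 0

/-- The discrete Euler-Lagrange equation `□_{-ε}(P □_ε x) + Q x = 0` at the time `t`,
for the operator `□_ε = □_ε^{[r,r]}`. -/
def DELAt {d : ℕ} (P Q : Matrix (Fin d) (Fin d) ℝ) (a b r ε : ℝ)
    (x : ℝ → Fin d → ℂ) (t : ℝ) : Prop :=
  box a b 1 (rsCoeff r r ε) (-ε)
      (fun s => (toC P).mulVec (box a b 1 (rsCoeff r r ε) ε x s)) t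
    + (toC Q).mulVec (x t) = 0

/-- The companion matrix of the recurrence
`u_{n+1} = (2 I + (ε²/r²) P⁻¹Q) u_n - u_{n-1}`, which is the discrete Euler-Lagrange equation
for `u_n = x(a + 2nε)` when all characteristic functions equal one. -/
noncomputable def companion {d : ℕ} (P Q : Matrix (Fin d) (Fin d) ℝ) (r ε : ℝ) :
    Matrix (Fin d ⊕ Fin d) (Fin d ⊕ Fin d) ℂ :=
  Matrix.fromBlocks (2 + ((ε ^ 2 / r ^ 2 : ℝ) : ℂ) • toC (P⁻¹ * Q)) (-1) 1 0

/-- `y` is pseudo-periodic on `[a,b]` with the phases of the recurrence: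
`y(t) = ∑_θ exp(iθ (t-a)/(2ε)) w_θ`, a finite sum over real `θ ∈ (-π, π]` such that `exp(iθ)` is
an eigenvalue of the companion matrix. -/
def IsPseudoPeriodic {d : ℕ} (P Q : Matrix (Fin d) (Fin d) ℝ) (a b r ε : ℝ)
    (y : ℝ → Fin d → ℂ) : Prop :=
  ∃ (S : Finset ℝ) (w : ℝ → Fin d → ℂ),
    (∀ θ ∈ S, θ ∈ Set.Ioc (-Real.pi) Real.pi ∧
      Complex.exp (Complex.I * θ) ∈ spectrum ℂ (companion P Q r ε)) ∧
    ∀ t ∈ Set.Icc a b,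
      y t = ∑ θ ∈ S, Complex.exp (Complex.I * θ * ((t - a) / (2 * ε))) • w θ

/-- `y` is a pseudo-periodic solution of the discrete Euler-Lagrange equation on
`[a + 2ε, b - 2ε]`. -/
def IsPseudoPeriodicDEL {d : ℕ} (P Q : Matrix (Fin d) (Fin d) ℝ) (a b r ε : ℝ)
    (y : ℝ → Fin d → ℂ) : Prop :=
  IsPseudoPeriodic P Q a b r ε y ∧
    ∀ t ∈ Set.Icc (a + 2 * ε) (b - 2 * ε), DELAt P Q a b r ε y t

/-- The pseudo-periodic discrete solution with the Dirichlet conditions `y(a) = da`,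
`y(b) = db`. -/
def IsDiscreteSolution {d : ℕ} (P Q : Matrix (Fin d) (Fin d) ℝ) (a b r ε : ℝ)
    (da db : Fin d → ℂ) (y : ℝ → Fin d → ℂ) : Prop :=
  IsPseudoPeriodicDEL P Q a b r ε y ∧ y a = da ∧ y b = db

/-- The pseudo-periodic discrete solution when the Dirichlet data enter through the discrete
Euler-Lagrange equation at the end points: on `[a + 2ε, b - 2ε]` the function `y` agrees with some
`x` which satisfies `x(a) = da`, `x(b) = db` and the discrete equation at `t = a` and `t = b`. -/
def IsDiscreteSolutionEndpoint {d : ℕ} (P Q : Matrix (Fin d) (Fin d) ℝ) (a b r ε : ℝ)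
    (da db : Fin d → ℂ) (y : ℝ → Fin d → ℂ) : Prop :=
  IsPseudoPeriodicDEL P Q a b r ε y ∧
    ∃ x : ℝ → Fin d → ℂ, x a = da ∧ x b = db ∧
      DELAt P Q a b r ε x a ∧ DELAt P Q a b r ε x b ∧
      Set.EqOn x y (Set.Icc (a + 2 * ε) (b - 2 * ε))

/-- The non-resonance condition. For `|1 - (b-a)²ω²/(2r²n²)| > 1` the number
`arccos(1 - (b-a)²ω²/(2r²n²))` is not real, so that the second requirement is void. -/
def NonResonant {d : ℕ} (Ω : Matrix (Fin d) (Fin d) ℝ) (a b r : ℝ) : Prop :=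
  ∀ ω ∈ spectrum ℝ Ω, Irrational ((b - a) * ω / Real.pi) ∧
    ∀ n : ℕ, 1 ≤ n → 1 - (b - a) ^ 2 * ω ^ 2 / (2 * r ^ 2 * n ^ 2) ∈ Set.Icc (-1 : ℝ) 1 →
      Irrational (Real.arccos (1 - (b - a) ^ 2 * ω ^ 2 / (2 * r ^ 2 * n ^ 2)) / Real.pi)

/-- The numbers of steps `M = (b-a)/ε` under consideration: even, at least `6`, with
`ε |ω| < 2|r|` for all eigenvalues `ω` of `Ω` (oscillatory regime). -/
def Admissible {d : ℕ} (Ω : Matrix (Fin d) (Fin d) ℝ) (a b r : ℝ) (M : ℕ) : Prop :=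
  Even M ∧ 6 ≤ M ∧ ∀ ω ∈ spectrum ℝ Ω, (b - a) / M * |ω| < 2 * |r|

end DiscreteEL

/-! Diagonalising `Ω` decouples both boundary value problems. In the coordinates `S.mulVec x` the
classical equation becomes `v'' = -ν² v`. The discrete one becomes `v(t+2ε) + v(t-2ε) = (2 -
ε²ν²/r²) v(t)`, with `ν = |D i|`, and in the oscillatory regime `2 - ε²ν²/r² = 2 cos θ` with `θ = 2
arcsin (εν/(2|r|))` in `(0, π)`.

With `s = (t-a)/(2ε)`, the discrete equation holds for all real `s` in an interval of positive
length, where exponentials with distinct frequencies are independent. A pseudo-periodic mode can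
therefore only contain the phases `±θ` (`IsModal.isSinusoid_of_isPseudoPeriodicDEL`). Classical and
discrete modes are thus both sinusoids of known frequency, determined by their values at `p` and `q`
when `sin (θ(q-p)) ≠ 0` (`IsSinusoid.eqOn_sineInterp`). Non-resonance supplies this: `θ/π` is
irrational and `q - p` is a positive integer in the discrete case.

For `M = 2k` steps, `kθ` tends to `c = (b-a)ν/(2|r|)`, which is the classical `(b-a)ν` exactly when
`|r| = 1/2`. In that case the interpolation formulas converge uniformly
(`tendstoUniformlyOn_sineInterp`). Conversely, pointwise convergence of one mode identifies the two
frequencies (`eq_of_tendsto_sineInterp`).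

At an endpoint, truncation by the characteristic functions leaves a two-point relation with factor
`1 - ε²ν²/r²`, which tends to `1`. Both kinds of boundary data are then instances of
`IsModal.discrete_boundary_problem`, with offset `j = 0` or `j = 1`. -/

namespace DiscreteEL

/-! ### Modal coordinates. -/

/-- `T` and its inverse `S` diagonalise `P⁻¹Q`, with eigenvalues `-ν i ^ 2`. -/
structure IsModal {d : ℕ} (P Q : Matrix (Fin d) (Fin d) ℝ) (T S : Matrix (Fin d) (Fin d) ℂ)
    (ν : Fin d → ℝ) : Prop where
  mul_inv : T * S = 1
  inv_mul : S * T = 1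
  injective : ∀ u, (toC P).mulVec u = 0 → u = 0
  potential : toC Q = -(toC P * (T * Matrix.diagonal (fun i => ((ν i : ℂ)) ^ 2) * S))
  quotient : toC (P⁻¹ * Q) = -(T * Matrix.diagonal (fun i => ((ν i : ℂ)) ^ 2) * S)

lemma toC_mul {d : ℕ} (A B : Matrix (Fin d) (Fin d) ℝ) : toC (A * B) = toC A * toC B :=
  Matrix.map_mul (f := Complex.ofRealHom)

lemma toC_one {d : ℕ} : toC (1 : Matrix (Fin d) (Fin d) ℝ) = 1 :=
  Matrix.map_one _ Complex.ofReal_zero Complex.ofReal_one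

lemma toC_diagonal {d : ℕ} (D : Fin d → ℝ) :
    toC (Matrix.diagonal D) = Matrix.diagonal (fun i => (D i : ℂ)) :=
  Matrix.diagonal_map Complex.ofReal_zero

/-- Squaring `Ω` forgets the signs of its eigenvalues, so the frequencies can be taken to be `|D
i|`. Keeping `D i` in the spectrum makes the non-resonance condition available for each mode. -/
lemma exists_isModal {d : ℕ} {P Q Ω : Matrix (Fin d) (Fin d) ℝ} (hP : IsUnit P.det)
    (hΩ : -(P⁻¹ * Q) = Ω ^ 2) (hdiag : IsDiagonalizable Ω) :
    ∃ (T S : Matrix (Fin d) (Fin d) ℂ) (D : Fin d → ℝ), IsModal P Q T S (fun i => |D i|) ∧ ∀ i, D i ∈ spectrum ℝ Ω := by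
  obtain ⟨B, D, hB, hD⟩ := hdiag
  have h1 : B * B⁻¹ = 1 := Matrix.mul_nonsing_inv _ hB
  have h2 : B⁻¹ * B = 1 := Matrix.nonsing_inv_mul _ hB
  have hΩ' : Ω = B * Matrix.diagonal D * B⁻¹ := by
    rw [← hD]
    calc Ω = (B * B⁻¹) * Ω * (B * B⁻¹) := by rw [h1]; simp
      _ = _ := by simp only [Matrix.mul_assoc]
  have hsq : P⁻¹ * Q = -(B * Matrix.diagonal (fun i => |D i| ^ 2) * B⁻¹) := by
    rw [← neg_eq_iff_eq_neg, hΩ, hΩ', sq]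
    calc B * Matrix.diagonal D * B⁻¹ * (B * Matrix.diagonal D * B⁻¹)
        = B * Matrix.diagonal D * (B⁻¹ * B) * Matrix.diagonal D * B⁻¹ := by
          simp only [Matrix.mul_assoc]
      _ = B * (Matrix.diagonal D * Matrix.diagonal D) * B⁻¹ := by
          rw [h2]; simp [Matrix.mul_assoc]
      _ = _ := by
          rw [Matrix.diagonal_mul_diagonal]
          simp [sq]
  have hquot : toC (P⁻¹ * Q) =
      -(toC B * Matrix.diagonal (fun i => ((|D i| : ℝ) : ℂ) ^ 2) * toC B⁻¹) := by
    have hneg : ∀ A : Matrix (Fin d) (Fin d) ℝ, toC (-A) = -toC A := by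
      intro A; ext i j; simp [toC]
    rw [hsq, hneg, toC_mul, toC_mul, toC_diagonal]
    simp only [Complex.ofReal_pow]
  refine ⟨toC B, toC B⁻¹, D, ⟨?_, ?_, ?_, ?_, hquot⟩, ?_⟩
  · rw [← toC_mul, h1, toC_one]
  · rw [← toC_mul, h2, toC_one]
  · intro u hu
    have : (toC P⁻¹).mulVec ((toC P).mulVec u) = 0 := by rw [hu]; simp
    rwa [Matrix.mulVec_mulVec, ← toC_mul, Matrix.nonsing_inv_mul _ hP, toC_one,
      Matrix.one_mulVec] at this
  · have : toC Q = toC P * toC (P⁻¹ * Q) := by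
      rw [← toC_mul, ← Matrix.mul_assoc, Matrix.mul_nonsing_inv _ hP, Matrix.one_mul]
    rw [this, hquot, Matrix.mul_neg]
  · intro i
    rw [spectrum.mem_iff, Matrix.isUnit_iff_isUnit_det]
    have : algebraMap ℝ (Matrix (Fin d) (Fin d) ℝ) (D i) - Ω =
        B * Matrix.diagonal (fun j => D i - D j) * B⁻¹ := by
      have hd : Matrix.diagonal (fun j => D i - D j) =
          algebraMap ℝ (Matrix (Fin d) (Fin d) ℝ) (D i) - Matrix.diagonal D := by
        rw [Matrix.algebraMap_eq_diagonal, Matrix.diagonal_sub]; rfl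
      rw [hd, Matrix.mul_sub, Matrix.sub_mul, ← hΩ', ← Algebra.commutes, Matrix.mul_assoc, h1,
        Matrix.mul_one]
    rw [this, Matrix.det_mul, Matrix.det_mul, Matrix.det_diagonal,
      Finset.prod_eq_zero (Finset.mem_univ i) (sub_self _)]
    simp

namespace IsModal

variable {d : ℕ} {P Q : Matrix (Fin d) (Fin d) ℝ} {T S : Matrix (Fin d) (Fin d) ℂ}
  {ν : Fin d → ℝ}

lemma mulVec_mulVec (h : IsModal P Q T S ν) (u : Fin d → ℂ) : T.mulVec (S.mulVec u) = u := by
  rw [Matrix.mulVec_mulVec, h.mul_inv, Matrix.one_mulVec]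

lemma mulVec_mulVec' (h : IsModal P Q T S ν) (u : Fin d → ℂ) : S.mulVec (T.mulVec u) = u := by
  rw [Matrix.mulVec_mulVec, h.inv_mul, Matrix.one_mulVec]

lemma modes_injective (h : IsModal P Q T S ν) {u v : Fin d → ℂ}
    (huv : ∀ i, S.mulVec u i = S.mulVec v i) : u = v := by
  rw [← h.mulVec_mulVec u, ← h.mulVec_mulVec v, funext huv]

/-- `P` factors out of the left side and is injective, after which `S` diagonalises what remains.
The scalar `κ` covers the classical equation (`κ = -1`) and the discrete ones (`κ = r²/ε²`). -/
lemma eq_iff (h : IsModal P Q T S ν) (κ : ℂ) (u x : Fin d → ℂ) :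
    κ • (toC P).mulVec u + (toC Q).mulVec x = 0 ↔
      ∀ i, κ * S.mulVec u i = (ν i : ℂ) ^ 2 * S.mulVec x i := by
  have key : κ • (toC P).mulVec u + (toC Q).mulVec x =
      (toC P).mulVec (κ • u -
        T.mulVec ((Matrix.diagonal (fun i => ((ν i : ℂ)) ^ 2)).mulVec (S.mulVec x))) := by
    rw [h.potential, Matrix.mulVec_sub, Matrix.mulVec_smul, Matrix.neg_mulVec, ← sub_eq_add_neg]
    simp only [Matrix.mulVec_mulVec, Matrix.mul_assoc]
  rw [key]
  constructor
  · intro h0 i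
    have h1 := sub_eq_zero.1 (h.injective _ h0)
    have h2 := congrFun (congrArg S.mulVec h1) i
    rwa [h.mulVec_mulVec', Matrix.mulVec_smul, Matrix.mulVec_diagonal, Pi.smul_apply,
      smul_eq_mul] at h2
  · intro h0
    have : κ • u =
        T.mulVec ((Matrix.diagonal (fun i => ((ν i : ℂ)) ^ 2)).mulVec (S.mulVec x)) := by
      apply h.modes_injective
      intro i
      rw [h.mulVec_mulVec', Matrix.mulVec_smul, Matrix.mulVec_diagonal, Pi.smul_apply,
        smul_eq_mul, h0]
    rw [this, sub_self, Matrix.mulVec_zero]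

end IsModal

/-! ### The discrete equation as a scalar recurrence. -/

/-- For `s = r` the middle coefficient vanishes. The step `ε'` is separate from `ε` because `□_{-ε}`
reverses the shifts but keeps the coefficients of `□_ε`. -/
lemma box_rsCoeff {d : ℕ} (a b r ε ε' : ℝ) (x : ℝ → Fin d → ℂ) (t : ℝ) :
    box a b 1 (rsCoeff r r ε) ε' x t =
      ((r : ℂ) / ε * chi a b ε' (-1) t) • x (t + ε') -
        ((r : ℂ) / ε * chi a b ε' 1 t) • x (t - ε') := by
  have : Finset.Icc (-((1 : ℕ) : ℤ)) ((1 : ℕ) : ℤ) = {-1, 0, 1} := by decide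
  rw [box, this]
  simp [rsCoeff, neg_div, sub_eq_add_neg]
  abel

lemma chi_eq_one {a b ε : ℝ} {i : ℤ} {t : ℝ} (h1 : a ≤ t) (h2 : a + i * ε ≤ t) (h3 : t ≤ b)
    (h4 : t ≤ b + i * ε) : chi a b ε i t = 1 :=
  Set.indicator_of_mem (Set.mem_Icc.2 ⟨max_le h1 h2, le_min h3 h4⟩) _

lemma chi_one_eq_one {a b ε t : ℝ} (h1 : a ≤ t) (h2 : a + ε ≤ t) (h3 : t ≤ b)
    (h4 : t ≤ b + ε) : chi a b ε 1 t = 1 :=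
  chi_eq_one h1 (by simpa using h2) h3 (by simpa using h4)

lemma chi_neg_one_eq_one {a b ε t : ℝ} (h1 : a ≤ t) (h2 : a - ε ≤ t) (h3 : t ≤ b)
    (h4 : t ≤ b - ε) : chi a b ε (-1) t = 1 :=
  chi_eq_one h1 (by simpa using h2) h3 (by simpa [sub_eq_add_neg] using h4)

lemma chi_eq_zero {a b ε : ℝ} {i : ℤ} {t : ℝ} (h : t < a + i * ε ∨ b + i * ε < t) :
    chi a b ε i t = 0 := by
  refine Set.indicator_of_notMem (fun hm => ?_) _
  rcases h with h | h
  · exact absurd ((le_max_right _ _).trans hm.1) (not_le.2 h)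
  · exact absurd (hm.2.trans (min_le_right _ _)) (not_le.2 h)

section Del

variable {d : ℕ} {P Q : Matrix (Fin d) (Fin d) ℝ} {T S : Matrix (Fin d) (Fin d) ℂ}
  {ν : Fin d → ℝ} {a b r ε : ℝ}

/-- At distance at least `2ε` from both ends every characteristic function involved equals one, so
the composition is the second difference of step `2ε` times `-r²/ε²`. -/
lemma IsModal.delAt_interior_iff (h : IsModal P Q T S ν) (hr : r ≠ 0) (hε : 0 < ε)
    (x : ℝ → Fin d → ℂ) {t : ℝ} (ht : t ∈ Set.Icc (a + 2 * ε) (b - 2 * ε)) :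
    DELAt P Q a b r ε x t ↔ ∀ i, S.mulVec (x (t + 2 * ε)) i + S.mulVec (x (t - 2 * ε)) i =
      ((2 - ε ^ 2 * ν i ^ 2 / r ^ 2 : ℝ) : ℂ) * S.mulVec (x t) i := by
  obtain ⟨h1, h2⟩ := ht
  have hr' : (r : ℂ) ≠ 0 := by exact_mod_cast hr
  have hε' : (ε : ℂ) ≠ 0 := by exact_mod_cast hε.ne'
  have e : box a b 1 (rsCoeff r r ε) (-ε)
      (fun s => (toC P).mulVec (box a b 1 (rsCoeff r r ε) ε x s)) t =
      ((r : ℂ) ^ 2 / ε ^ 2) • (toC P).mulVec ((2 : ℂ) • x t - x (t + 2 * ε) - x (t - 2 * ε)) := by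
    simp only [box_rsCoeff]
    repeat rw [chi_one_eq_one (by linarith) (by linarith) (by linarith) (by linarith)]
    repeat rw [chi_neg_one_eq_one (by linarith) (by linarith) (by linarith) (by linarith)]
    rw [show t + -ε + ε = t by ring, show t - -ε - ε = t by ring,
      show t + -ε - ε = t - 2 * ε by ring, show t - -ε + ε = t + 2 * ε by ring]
    rw [← Matrix.mulVec_smul, ← Matrix.mulVec_smul, ← Matrix.mulVec_smul, ← Matrix.mulVec_sub]
    congr 1
    ext i
    simp
    ring
  rw [DELAt, e, h.eq_iff]
  refine forall_congr' fun i => ?_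
  simp only [Matrix.mulVec_sub, Matrix.mulVec_smul, Pi.sub_apply, Pi.smul_apply, smul_eq_mul]
  push_cast
  constructor
  · intro h0
    field_simp at h0 ⊢
    linear_combination -h0
  · intro h0
    field_simp at h0 ⊢
    linear_combination -h0

/-- At `t = a` the outer term that would shift to `a - ε` is cut off, which leaves `x a - x (a +
2ε)` in place of the second difference. -/
lemma IsModal.delAt_left_iff (h : IsModal P Q T S ν) (hr : r ≠ 0) (hε : 0 < ε)
    (hab : a + 2 * ε ≤ b) (x : ℝ → Fin d → ℂ) :
    DELAt P Q a b r ε x a ↔ ∀ i, S.mulVec (x (a + 2 * ε)) i =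
      ((1 - ε ^ 2 * ν i ^ 2 / r ^ 2 : ℝ) : ℂ) * S.mulVec (x a) i := by
  have hr' : (r : ℂ) ≠ 0 := by exact_mod_cast hr
  have hε' : (ε : ℂ) ≠ 0 := by exact_mod_cast hε.ne'
  have e : box a b 1 (rsCoeff r r ε) (-ε)
      (fun s => (toC P).mulVec (box a b 1 (rsCoeff r r ε) ε x s)) a =
      ((r : ℂ) ^ 2 / ε ^ 2) • (toC P).mulVec (x a - x (a + 2 * ε)) := by
    simp only [box_rsCoeff]
    rw [chi_eq_zero (ε := -ε) (i := -1) (Or.inl (by push_cast; linarith)),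
      mul_zero, zero_smul, zero_sub]
    repeat rw [chi_one_eq_one (by linarith) (by linarith) (by linarith) (by linarith)]
    repeat rw [chi_neg_one_eq_one (by linarith) (by linarith) (by linarith) (by linarith)]
    rw [show a - -ε - ε = a by ring, show a - -ε + ε = a + 2 * ε by ring]
    rw [← Matrix.mulVec_smul, ← Matrix.mulVec_smul,
      ← Matrix.mulVec_neg]
    congr 1
    ext i
    simp
    ring
  rw [DELAt, e, h.eq_iff]
  refine forall_congr' fun i => ?_
  simp only [Matrix.mulVec_sub, Pi.sub_apply]
  push_cast
  constructor
  · intro h0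
    field_simp at h0 ⊢
    linear_combination -h0
  · intro h0
    field_simp at h0 ⊢
    linear_combination -h0

lemma IsModal.delAt_right_iff (h : IsModal P Q T S ν) (hr : r ≠ 0) (hε : 0 < ε)
    (hab : a + 2 * ε ≤ b) (x : ℝ → Fin d → ℂ) :
    DELAt P Q a b r ε x b ↔ ∀ i, S.mulVec (x (b - 2 * ε)) i =
      ((1 - ε ^ 2 * ν i ^ 2 / r ^ 2 : ℝ) : ℂ) * S.mulVec (x b) i := by
  have hr' : (r : ℂ) ≠ 0 := by exact_mod_cast hr
  have hε' : (ε : ℂ) ≠ 0 := by exact_mod_cast hε.ne'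
  have e : box a b 1 (rsCoeff r r ε) (-ε)
      (fun s => (toC P).mulVec (box a b 1 (rsCoeff r r ε) ε x s)) b =
      ((r : ℂ) ^ 2 / ε ^ 2) • (toC P).mulVec (x b - x (b - 2 * ε)) := by
    simp only [box_rsCoeff]
    rw [chi_eq_zero (ε := -ε) (i := 1) (Or.inr (by push_cast; linarith)),
      mul_zero, zero_smul, sub_zero]
    repeat rw [chi_one_eq_one (by linarith) (by linarith) (by linarith) (by linarith)]
    repeat rw [chi_neg_one_eq_one (by linarith) (by linarith) (by linarith) (by linarith)]
    rw [show b + -ε - ε = b - 2 * ε by ring, show b + -ε + ε = b by ring]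
    rw [← Matrix.mulVec_smul, ← Matrix.mulVec_smul]
    congr 1
    ext i
    simp
    ring
  rw [DELAt, e, h.eq_iff]
  refine forall_congr' fun i => ?_
  simp only [Matrix.mulVec_sub, Pi.sub_apply]
  push_cast
  constructor
  · intro h0
    field_simp at h0 ⊢
    linear_combination -h0
  · intro h0
    field_simp at h0 ⊢
    linear_combination -h0

end Del

/-! ### Exponentials, sinusoids and two-point interpolation. -/

/-- Finitely many exponentials with distinct frequencies are independent on an interval. -/
lemma coeff_eq_zero_of_sum_exp_eq_zero {p q : ℝ} (hpq : p < q) (S : Finset ℝ) (c : ℝ → ℂ)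
    (h : ∀ s ∈ Set.Ioo p q, ∑ θ ∈ S, Complex.exp (Complex.I * θ * s) * c θ = 0) :
    ∀ θ ∈ S, c θ = 0 := by
  classical
  induction S using Finset.induction_on generalizing c with
  | empty => simp
  | insert θ₀ S hS ih =>
    -- Differentiating the relation and subtracting `iθ₀` times it removes the term `θ₀` and
    -- multiplies the other coefficients by the nonzero numbers `i(θ - θ₀)`.
    have hS0 : ∀ θ ∈ S, (Complex.I * (θ - θ₀)) * c θ = 0 := by
      apply ih (fun θ => (Complex.I * (θ - θ₀)) * c θ)
      intro s hs
      have hd : ∀ θ : ℝ, HasDerivAt (fun s : ℝ => Complex.exp (Complex.I * θ * s) * c θ)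
          (Complex.exp (Complex.I * θ * s) * (Complex.I * θ * 1) * c θ) s := fun θ =>
        (((Complex.ofRealCLM.hasDerivAt (x := s)).const_mul (Complex.I * (θ : ℂ))).cexp).mul_const _
      have hd' := HasDerivAt.fun_sum (u := insert θ₀ S) (fun θ _ => hd θ)
      have hz : (fun s : ℝ => ∑ θ ∈ insert θ₀ S, Complex.exp (Complex.I * θ * s) * c θ)
          =ᶠ[nhds s] fun _ => 0 := by
        filter_upwards [Ioo_mem_nhds hs.1 hs.2] with s' hs' using h s' hs'
      have h1 := hd'.unique ((hasDerivAt_const s (0 : ℂ)).congr_of_eventuallyEq hz)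
      have h2 := h s hs
      rw [Finset.sum_insert hS] at h1 h2
      calc ∑ θ ∈ S, Complex.exp (Complex.I * θ * s) * (Complex.I * (θ - θ₀) * c θ)
          = ∑ θ ∈ S, Complex.exp (Complex.I * θ * s) * (Complex.I * θ * 1) * c θ -
            Complex.I * θ₀ * ∑ θ ∈ S, Complex.exp (Complex.I * θ * s) * c θ := by
              rw [Finset.mul_sum, ← Finset.sum_sub_distrib]
              exact Finset.sum_congr rfl fun θ _ => by ring
        _ = 0 := by linear_combination h1 - Complex.I * θ₀ * h2
    have hS1 : ∀ θ ∈ S, c θ = 0 := by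
      intro θ hθ
      have hne : (θ : ℂ) - θ₀ ≠ 0 := by
        rw [sub_ne_zero]
        intro he
        exact hS (Complex.ofReal_injective he ▸ hθ)
      simpa [hne, Complex.I_ne_zero] using hS0 θ hθ
    intro θ hθ
    rcases Finset.mem_insert.1 hθ with rfl | hθ
    · have h2 := h ((p + q) / 2) ⟨by linarith, by linarith⟩
      rw [Finset.sum_insert hS, Finset.sum_eq_zero fun θ hθ => by rw [hS1 θ hθ, mul_zero]] at h2
      simpa using h2
    · exact hS1 θ hθ

/-- The combination of `sin (θ (q - s))` and `sin (θ (s - p))` with value `α` at `s = p` and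
`β` at `s = q`. -/
noncomputable def sineInterp (θ p q : ℝ) (α β : ℂ) (s : ℝ) : ℂ :=
  (α * Real.sin (θ * (q - s)) + β * Real.sin (θ * (s - p))) / Real.sin (θ * (q - p))

/-- On `I` the function `v` is a combination of `cos (θ s)` and `sin (θ s)`. -/
def IsSinusoid (θ : ℝ) (I : Set ℝ) (v : ℝ → ℂ) : Prop :=
  ∃ C E : ℂ, ∀ s ∈ I, v s = C * Real.cos (θ * s) + E * Real.sin (θ * s)

lemma isSinusoid_sineInterp (θ p q : ℝ) (α β : ℂ) (I : Set ℝ) :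
    IsSinusoid θ I (sineInterp θ p q α β) := by
  refine ⟨(α * Real.sin (θ * q) - β * Real.sin (θ * p)) / Real.sin (θ * (q - p)),
    (β * Real.cos (θ * p) - α * Real.cos (θ * q)) / Real.sin (θ * (q - p)), fun s _ => ?_⟩
  rw [sineInterp, mul_sub θ q s, mul_sub θ s p, Real.sin_sub (θ * q), Real.sin_sub (θ * s)]
  push_cast
  ring

/-- `sin (θ(q-p))` is the determinant of evaluation at `p` and `q` on the span of `cos (θ s)` and
`sin (θ s)`. -/
lemma IsSinusoid.eqOn_sineInterp {θ : ℝ} {I : Set ℝ} {v : ℝ → ℂ} (hv : IsSinusoid θ I v)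
    {p q : ℝ} (hp : p ∈ I) (hq : q ∈ I) (h : Real.sin (θ * (q - p)) ≠ 0) :
    Set.EqOn v (sineInterp θ p q (v p) (v q)) I := by
  obtain ⟨C, E, hCE⟩ := hv
  intro s hs
  have h' : (Real.sin (θ * (q - p)) : ℂ) ≠ 0 := by exact_mod_cast h
  rw [sineInterp, eq_div_iff h', hCE s hs, hCE p hp, hCE q hq]
  rw [mul_sub, mul_sub, mul_sub, Real.sin_sub, Real.sin_sub, Real.sin_sub]
  have e1 : (Real.sin (θ * p) : ℂ) ^ 2 = 1 - (Real.cos (θ * p) : ℂ) ^ 2 := by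
    exact_mod_cast Real.sin_sq _
  have e2 : (Real.sin (θ * q) : ℂ) ^ 2 = 1 - (Real.cos (θ * q) : ℂ) ^ 2 := by
    exact_mod_cast Real.sin_sq _
  push_cast at *
  ring

lemma sineInterp_left {θ p q : ℝ} (h : Real.sin (θ * (q - p)) ≠ 0) (α β : ℂ) :
    sineInterp θ p q α β p = α := by
  have h' : (Real.sin (θ * (q - p)) : ℂ) ≠ 0 := by exact_mod_cast h
  rw [sineInterp, div_eq_iff h']
  simp

lemma sineInterp_right {θ p q : ℝ} (h : Real.sin (θ * (q - p)) ≠ 0) (α β : ℂ) :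
    sineInterp θ p q α β q = β := by
  have h' : (Real.sin (θ * (q - p)) : ℂ) ≠ 0 := by exact_mod_cast h
  rw [sineInterp, div_eq_iff h']
  simp

lemma hasDerivAt_sineInterp (θ p q : ℝ) (α β : ℂ) (t : ℝ) :
    HasDerivAt (sineInterp θ p q α β)
      ((-α * Real.cos (θ * (q - t)) + β * Real.cos (θ * (t - p))) * θ /
        Real.sin (θ * (q - p))) t := by
  have h1 : HasDerivAt (fun s : ℝ => (Real.sin (θ * (q - s)) : ℂ))
      ((Real.cos (θ * (q - t)) * (θ * (-1)) : ℝ)) t :=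
    ((((hasDerivAt_id t).const_sub q).const_mul θ).sin).ofReal_comp
  have h2 : HasDerivAt (fun s : ℝ => (Real.sin (θ * (s - p)) : ℂ))
      ((Real.cos (θ * (t - p)) * (θ * 1) : ℝ)) t :=
    ((((hasDerivAt_id t).sub_const p).const_mul θ).sin).ofReal_comp
  refine (((h1.const_mul α).add (h2.const_mul β)).div_const _).congr_deriv ?_
  push_cast
  ring

lemma hasDerivAt_deriv_sineInterp (θ p q : ℝ) (α β : ℂ) (t : ℝ) :
    HasDerivAt (fun t : ℝ => (-α * Real.cos (θ * (q - t)) + β * Real.cos (θ * (t - p))) * θ /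
        Real.sin (θ * (q - p)))
      (-(θ : ℂ) ^ 2 * sineInterp θ p q α β t) t := by
  have h1 : HasDerivAt (fun s : ℝ => (Real.cos (θ * (q - s)) : ℂ))
      ((-Real.sin (θ * (q - t)) * (θ * (-1)) : ℝ)) t :=
    ((((hasDerivAt_id t).const_sub q).const_mul θ).cos).ofReal_comp
  have h2 : HasDerivAt (fun s : ℝ => (Real.cos (θ * (s - p)) : ℂ))
      ((-Real.sin (θ * (t - p)) * (θ * 1) : ℝ)) t :=
    ((((hasDerivAt_id t).sub_const p).const_mul θ).cos).ofReal_comp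
  refine ((((h1.const_mul (-α)).add (h2.const_mul β)).mul_const (θ : ℂ)).div_const _).congr_deriv ?_
  rw [sineInterp]
  push_cast
  ring

/-- Solutions of the harmonic oscillator equation are combinations of sine and cosine. -/
lemma isSinusoid_of_oscillator {a b ν : ℝ} (hab : a < b) (hν : ν ≠ 0) {v v₁ v₂ : ℝ → ℂ}
    (h1 : ∀ t ∈ Set.Icc a b, HasDerivWithinAt v (v₁ t) (Set.Icc a b) t)
    (h2 : ∀ t ∈ Set.Icc a b, HasDerivWithinAt v₁ (v₂ t) (Set.Icc a b) t)
    (h3 : ∀ t ∈ Set.Icc a b, v₂ t = -(ν : ℂ) ^ 2 * v t) : IsSinusoid ν (Set.Icc a b) v := by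
  have hν' : (ν : ℂ) ≠ 0 := by exact_mod_cast hν
  -- For fixed `c` the function `t ↦ v₁ t sin (ν(c-t)) + ν v t cos (ν(c-t))` has zero derivative;
  -- the identity compares its values at `c` and `a`.
  have key : ∀ c ∈ Set.Icc a b, (ν : ℂ) * v c =
      v₁ a * Real.sin (ν * (c - a)) + ν * v a * Real.cos (ν * (c - a)) := by
    intro c hc
    have hW : ∀ t ∈ Set.Icc a b, HasDerivWithinAt
        (fun t => v₁ t * Real.sin (ν * (c - t)) + ν * v t * Real.cos (ν * (c - t))) 0
        (Set.Icc a b) t := by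
      intro t ht
      have hs : HasDerivAt (fun s : ℝ => (Real.sin (ν * (c - s)) : ℂ))
          ((Real.cos (ν * (c - t)) * (ν * (-1)) : ℝ)) t :=
        ((((hasDerivAt_id t).const_sub c).const_mul ν).sin).ofReal_comp
      have hc : HasDerivAt (fun s : ℝ => (Real.cos (ν * (c - s)) : ℂ))
          ((-Real.sin (ν * (c - t)) * (ν * (-1)) : ℝ)) t :=
        ((((hasDerivAt_id t).const_sub c).const_mul ν).cos).ofReal_comp
      refine (((h2 t ht).mul hs.hasDerivWithinAt).add
        (((h1 t ht).const_mul (ν : ℂ)).mul hc.hasDerivWithinAt)).congr_deriv ?_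
      rw [h3 t ht]
      push_cast
      ring
    have hconst := (convex_Icc a b).is_const_of_fderivWithin_eq_zero (𝕜 := ℝ)
      (fun t ht => (hW t ht).differentiableWithinAt) (fun t ht => ?_) hc
      (Set.left_mem_Icc.2 hab.le)
    · simpa using hconst
    · rw [((hW t ht).hasFDerivWithinAt).fderivWithin (uniqueDiffOn_Icc hab t ht)]
      ext
      simp
  refine ⟨(-v₁ a * Real.sin (ν * a) + ν * v a * Real.cos (ν * a)) / ν,
    (v₁ a * Real.cos (ν * a) + ν * v a * Real.sin (ν * a)) / ν, fun c hc => ?_⟩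
  have := key c hc
  rw [mul_sub, Real.sin_sub, Real.cos_sub] at this
  push_cast at this ⊢
  field_simp
  linear_combination this

/-! ### The phase of a mode and its asymptotics. -/

/-- Double-angle formula, with `2 arcsin y` in `[0, π]`. It translates the arccosine of the
non-resonance condition into `phase`. -/
lemma arccos_one_sub_two_mul_sq {y : ℝ} (h0 : 0 ≤ y) (h1 : y ≤ 1) :
    Real.arccos (1 - 2 * y ^ 2) = 2 * Real.arcsin y := by
  have hc : Real.cos (2 * Real.arcsin y) = 1 - 2 * y ^ 2 := by
    rw [Real.cos_two_mul, Real.cos_sq', Real.sin_arcsin (by linarith) h1]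
    ring
  rw [← hc, Real.arccos_cos]
  · have := Real.arcsin_nonneg.2 h0; linarith
  · have := Real.arcsin_le_pi_div_two y; linarith

/-- The phase of a mode: `2 - ε²ν²/r² = 2 cos (phase c M)` for `ε = (b-a)/M`,
`c = (b-a)ν/(2|r|)`. -/
noncomputable def phase (c : ℝ) (M : ℕ) : ℝ := 2 * Real.arcsin (c / M)

lemma cos_phase {c : ℝ} {M : ℕ} (h0 : 0 < c) (h1 : c < M) :
    Real.cos (phase c M) = 1 - 2 * (c / M) ^ 2 := by
  have hM : (0 : ℝ) < M := h0.trans h1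
  have : c / M ≤ 1 := (div_le_one hM).2 h1.le
  have : 0 < c / M := div_pos h0 hM
  rw [phase, Real.cos_two_mul, Real.cos_sq', Real.sin_arcsin (by linarith) (by linarith)]
  ring

lemma phase_mem_Ioo {c : ℝ} {M : ℕ} (h0 : 0 < c) (h1 : c < M) :
    phase c M ∈ Set.Ioo 0 Real.pi := by
  have hM : (0 : ℝ) < M := h0.trans h1
  have h2 : c / M < 1 := (div_lt_one hM).2 h1
  have h3 := Real.arcsin_pos.2 (div_pos h0 hM)
  have h4 := Real.arcsin_lt_pi_div_two.2 h2
  rw [phase]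
  constructor <;> linarith

lemma tendsto_phase_zero (c : ℝ) :
    Filter.Tendsto (fun k : ℕ => phase c (2 * k)) Filter.atTop (nhds 0) := by
  have h1 : Filter.Tendsto (fun k : ℕ => c / ((2 * k : ℕ) : ℝ)) Filter.atTop (nhds 0) :=
    (tendsto_const_div_atTop_nhds_zero_nat c).comp
      (Filter.tendsto_id.const_mul_atTop' two_pos)
  simpa [phase] using ((Real.continuous_arcsin.tendsto 0).comp h1).const_mul 2

/-- Up to a factor `2`, this is the difference quotient of `x ↦ arcsin (c x / 2)` at `0` along `x =
1/k`. -/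
lemma tendsto_mul_phase (c : ℝ) :
    Filter.Tendsto (fun k : ℕ => k * phase c (2 * k)) Filter.atTop (nhds c) := by
  have hd : HasDerivAt (fun x => Real.arcsin (c / 2 * x)) (c / 2) 0 := by
    have h := Real.hasDerivAt_arcsin (x := c / 2 * 0) (by norm_num) (by norm_num)
    have h' := h.comp (0 : ℝ) ((hasDerivAt_id (0 : ℝ)).const_mul (c / 2))
    exact h'.congr_deriv (by simp)
  have ht := hd.tendsto_slope_zero_right
  have hinv : Filter.Tendsto (fun k : ℕ => ((k : ℝ))⁻¹) Filter.atTop (nhdsWithin 0 (Set.Ioi 0)) :=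
    tendsto_inv_atTop_nhdsGT_zero.comp tendsto_natCast_atTop_atTop
  have := (ht.comp hinv).const_mul 2
  refine (this.congr fun k => ?_).trans (by rw [mul_div_cancel₀ _ two_ne_zero])
  simp only [phase, Function.comp, inv_inv, zero_add, mul_zero, Real.arcsin_zero, sub_zero,
    smul_eq_mul]
  push_cast
  rw [show c / 2 * (k : ℝ)⁻¹ = c / (2 * k) by rw [← div_eq_mul_inv, div_div]]
  ring

lemma sin_nat_mul_ne_zero {θ : ℝ} (h : Irrational (θ / Real.pi)) {n : ℕ} (hn : n ≠ 0) :
    Real.sin (θ * n) ≠ 0 := by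
  intro h0
  obtain ⟨k, hk⟩ := Real.sin_eq_zero_iff.1 h0
  apply h
  refine ⟨(k : ℚ) / n, ?_⟩
  have : (n : ℝ) ≠ 0 := by exact_mod_cast hn
  push_cast
  rw [div_eq_div_iff this Real.pi_ne_zero, hk]

/-- If `sin (φ w)` and `sin (ψ w)` are proportional in the sense of the boundary value problem,
the frequencies agree. -/
lemma eq_of_sin_proportional {φ ψ : ℝ} (hφ : 0 < φ) (hψ : 0 < ψ) (hs : Real.sin ψ ≠ 0)
    (h : ∀ w ∈ Set.Icc (0 : ℝ) 1,
      Real.sin (φ * w) * Real.sin ψ = Real.sin φ * Real.sin (ψ * w)) : φ = ψ := by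
  -- Take `w` so small that `φ w` and `ψ w` lie in `(0, π)` and `2 w ≤ 1`. Comparing the relation at
  -- `w` and `2 w` gives `cos (φ w) = cos (ψ w)`, and cosine is injective on `[0, π]`.
  obtain ⟨w, hw0, hw1, hφw, hψw⟩ : ∃ w : ℝ, 0 < w ∧ w ≤ 1 / 2 ∧ φ * w < Real.pi ∧
      ψ * w < Real.pi := by
    refine ⟨min (1 / 2) (Real.pi / (2 * (φ + ψ))), lt_min (by norm_num) (by positivity),
      min_le_left _ _, ?_, ?_⟩
    all_goals
      have h1 := min_le_right (1 / 2 : ℝ) (Real.pi / (2 * (φ + ψ)))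
      rw [le_div_iff₀ (by positivity)] at h1
      have h2 : 0 < min (1 / 2 : ℝ) (Real.pi / (2 * (φ + ψ))) :=
        lt_min (by norm_num) (by positivity)
      nlinarith [Real.pi_pos, mul_pos h2 hφ, mul_pos h2 hψ]
  have h1 := h w ⟨hw0.le, by linarith⟩
  have h2 := h (2 * w) ⟨by linarith, by linarith⟩
  rw [show φ * (2 * w) = 2 * (φ * w) by ring, show ψ * (2 * w) = 2 * (ψ * w) by ring,
    Real.sin_two_mul, Real.sin_two_mul] at h2
  have hne : Real.sin (φ * w) ≠ 0 := (Real.sin_pos_of_pos_of_lt_pi (by positivity) hφw).ne'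
  have hcos : Real.cos (φ * w) = Real.cos (ψ * w) := by
    have : (Real.sin (φ * w) * Real.sin ψ) * (Real.cos (φ * w) - Real.cos (ψ * w)) = 0 := by
      linear_combination h2 / 2 - Real.cos (ψ * w) * h1
    exact sub_eq_zero.1 ((mul_eq_zero.1 this).resolve_left (mul_ne_zero hne hs))
  have := Real.injOn_cos ⟨by positivity, hφw.le⟩ ⟨by positivity, hψw.le⟩ hcos
  exact mul_right_cancel₀ hw0.ne' this

/-! ### Modes of classical and discrete solutions. -/

section Dynamics

variable {d : ℕ} {P Q : Matrix (Fin d) (Fin d) ℝ} {T S : Matrix (Fin d) (Fin d) ℂ}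
  {ν : Fin d → ℝ} {a b r ε : ℝ}

/-- With `z = exp (iφ)` one has `z² + 1 = 2 cos φ · z`, so `(z w, w)` is an eigenvector for the mode
`w = T e_i`. -/
lemma IsModal.exp_mem_spectrum_companion (h : IsModal P Q T S ν) (i : Fin d) {φ : ℝ}
    (hφ : 2 * Real.cos φ = 2 - ε ^ 2 * ν i ^ 2 / r ^ 2) :
    Complex.exp (Complex.I * φ) ∈ spectrum ℂ (companion P Q r ε) := by
  set z := Complex.exp (Complex.I * φ) with hz
  have hz2 : z ^ 2 + 1 = ((2 - ε ^ 2 * ν i ^ 2 / r ^ 2 : ℝ) : ℂ) * z := by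
    rw [← hφ, hz]
    push_cast
    rw [Complex.two_cos, mul_comm Complex.I, add_mul, ← Complex.exp_add, ← Complex.exp_add, sq,
      ← Complex.exp_add]
    simp
  set w := T.mulVec (Pi.single i 1) with hw
  have hSw : S.mulVec w = Pi.single i 1 := h.mulVec_mulVec' _
  have hQw : (toC (P⁻¹ * Q)).mulVec w = (-(ν i : ℂ) ^ 2) • w := by
    rw [h.quotient, Matrix.neg_mulVec, ← Matrix.mulVec_mulVec, ← Matrix.mulVec_mulVec, hSw,
      Matrix.diagonal_mulVec_single, hw, ← Matrix.mulVec_smul, ← Matrix.mulVec_neg]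
    congr 1
    ext j
    rcases eq_or_ne j i with rfl | hj
    · simp
    · simp [hj]
  have heig : (companion P Q r ε).mulVec (Sum.elim (z • w) w) = z • Sum.elim (z • w) w := by
    rw [companion, Matrix.fromBlocks_mulVec]
    ext j
    rcases j with j | j
    · rw [Sum.elim_comp_inl, Sum.elim_comp_inr, Pi.smul_apply, Sum.elim_inl, Sum.elim_inl,
        Pi.add_apply]
      rw [Matrix.mulVec_smul, Matrix.add_mulVec, Matrix.smul_mulVec, hQw, Matrix.neg_mulVec,
        Matrix.one_mulVec, ← one_add_one_eq_two, Matrix.add_mulVec, Matrix.one_mulVec]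
      simp only [Pi.smul_apply, Pi.add_apply, Pi.neg_apply, smul_eq_mul]
      push_cast at hz2 ⊢
      linear_combination (-w j) * hz2
    · simp [Function.comp_def]
  rw [spectrum.mem_iff]
  intro hu
  obtain ⟨U, hU⟩ := hu.exists_left_inv
  have h0 : (algebraMap ℂ (Matrix (Fin d ⊕ Fin d) (Fin d ⊕ Fin d) ℂ) z -
      companion P Q r ε).mulVec (Sum.elim (z • w) w) = 0 := by
    rw [Matrix.sub_mulVec, heig, Algebra.algebraMap_eq_smul_one, Matrix.smul_mulVec,
      Matrix.one_mulVec, sub_self]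
  have h1 := congrArg U.mulVec h0
  rw [Matrix.mulVec_mulVec, hU, Matrix.one_mulVec, Matrix.mulVec_zero] at h1
  have hw0 : w = 0 := funext fun j => congrFun h1 (Sum.inr j)
  rw [hw0, Matrix.mulVec_zero] at hSw
  simpa using congrFun hSw i

/-- The recurrence multiplies the amplitude of `exp (iφs)` by `2 cos φ - 2 cos θ`. It holds on `(1,
m - 1)`, nonempty because `m > 2`, so independence kills all amplitudes with `cos φ ≠ cos θ`. Within
`(-π, π]` only `φ = ±θ` survive. -/
lemma IsModal.isSinusoid_of_isPseudoPeriodicDEL (h : IsModal P Q T S ν) (hr : r ≠ 0)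
    (hε : 0 < ε) {m : ℝ} (hm : 2 < m) (hb : b = a + m * (2 * ε)) {θ : Fin d → ℝ}
    (hθ : ∀ i, θ i ∈ Set.Ioo 0 Real.pi)
    (hcos : ∀ i, 2 * Real.cos (θ i) = 2 - ε ^ 2 * ν i ^ 2 / r ^ 2) {y : ℝ → Fin d → ℂ}
    (hy : IsPseudoPeriodicDEL P Q a b r ε y) (i : Fin d) :
    IsSinusoid (θ i) (Set.Icc 0 m) (fun s => S.mulVec (y (a + s * (2 * ε))) i) := by
  obtain ⟨⟨F, w, hF, hyw⟩, hdel⟩ := hy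
  have hε' : (ε : ℂ) ≠ 0 := by exact_mod_cast hε.ne'
  have hmode : ∀ s ∈ Set.Icc 0 m, S.mulVec (y (a + s * (2 * ε))) i =
      ∑ φ ∈ F, Complex.exp (Complex.I * φ * s) * S.mulVec (w φ) i := by
    intro s hs
    rw [hyw _ ⟨by nlinarith [hs.1], by rw [hb]; nlinarith [hs.2]⟩, Matrix.mulVec_sum,
      Finset.sum_apply]
    refine Finset.sum_congr rfl fun φ _ => ?_
    rw [Matrix.mulVec_smul, Pi.smul_apply, smul_eq_mul]
    congr 3
    push_cast
    field_simp
    ring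
  have hzero : ∀ φ ∈ F, ((2 * Real.cos φ - 2 * Real.cos (θ i) : ℝ) : ℂ) * S.mulVec (w φ) i = 0 := by
    refine coeff_eq_zero_of_sum_exp_eq_zero (p := 1) (q := m - 1) (by linarith) F
      (fun φ => ((2 * Real.cos φ - 2 * Real.cos (θ i) : ℝ) : ℂ) * S.mulVec (w φ) i) ?_
    intro s hs
    have h1 := (h.delAt_interior_iff hr hε y (t := a + s * (2 * ε))
      ⟨by nlinarith [hs.1], by rw [hb]; nlinarith [hs.2]⟩).1
      (hdel _ ⟨by nlinarith [hs.1], by rw [hb]; nlinarith [hs.2]⟩) i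
    rw [show a + s * (2 * ε) + 2 * ε = a + (s + 1) * (2 * ε) by ring,
      show a + s * (2 * ε) - 2 * ε = a + (s - 1) * (2 * ε) by ring,
      hmode _ ⟨by linarith [hs.1], by linarith [hs.2]⟩,
      hmode _ ⟨by linarith [hs.1], by linarith [hs.2]⟩,
      hmode _ ⟨by linarith [hs.1], by linarith [hs.2]⟩, ← hcos, Finset.mul_sum,
      ← Finset.sum_add_distrib, ← sub_eq_zero, ← Finset.sum_sub_distrib] at h1
    rw [← h1]
    refine Finset.sum_congr rfl fun φ _ => ?_
    have e1 : Complex.exp (Complex.I * φ * ((s + 1 : ℝ) : ℂ)) =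
        Complex.exp (Complex.I * φ * s) * Complex.exp (φ * Complex.I) := by
      rw [← Complex.exp_add]; congr 1; push_cast; ring
    have e2 : Complex.exp (Complex.I * φ * ((s - 1 : ℝ) : ℂ)) =
        Complex.exp (Complex.I * φ * s) * Complex.exp (-φ * Complex.I) := by
      rw [← Complex.exp_add]; congr 1; push_cast; ring
    rw [e1, e2]
    have e3 := Complex.two_cos (φ : ℂ)
    push_cast
    linear_combination (Complex.exp (Complex.I * φ * s) * S.mulVec (w φ) i) * e3
  -- The sine coefficient is `i` for `φ = θ` and `-i` for `φ = -θ`; for other phases the amplitude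
  -- is zero, so the default `-1` is harmless.
  refine ⟨∑ φ ∈ F, S.mulVec (w φ) i,
    ∑ φ ∈ F, S.mulVec (w φ) i * (Complex.I * if φ = θ i then 1 else -1), fun s hs => ?_⟩
  simp only
  rw [hmode s hs, Finset.sum_mul, Finset.sum_mul, ← Finset.sum_add_distrib]
  refine Finset.sum_congr rfl fun φ hφ => ?_
  have hexp : Complex.exp (Complex.I * φ * s) =
      Real.cos (φ * s) + Real.sin (φ * s) * Complex.I := by
    rw [Complex.ofReal_cos, Complex.ofReal_sin, ← Complex.exp_mul_I]
    congr 1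
    push_cast
    ring
  rcases mul_eq_zero.1 (hzero φ hφ) with h0 | h0
  · have hc : Real.cos |φ| = Real.cos (θ i) := by
      rw [Real.cos_abs]
      have := Complex.ofReal_eq_zero.1 h0
      linarith
    have habs : |φ| = θ i := Real.injOn_cos
      ⟨abs_nonneg _, abs_le.2 ⟨(hF φ hφ).1.1.le, (hF φ hφ).1.2⟩⟩
      ⟨(hθ i).1.le, (hθ i).2.le⟩ hc
    rw [hexp]
    rcases (abs_eq (hθ i).1.le).1 habs with rfl | h1
    · rw [if_pos rfl]; ring
    · have hne : φ ≠ θ i := by have := (hθ i).1; intro h2; linarith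
      rw [if_neg hne, h1, neg_mul, Real.cos_neg, Real.sin_neg]
      push_cast
      ring
  · rw [h0]; simp

lemma IsModal.isPseudoPeriodicDEL_of_isSinusoid (h : IsModal P Q T S ν) (hr : r ≠ 0)
    (hε : 0 < ε) {m : ℝ} (hb : b = a + m * (2 * ε)) {θ : Fin d → ℝ}
    (hθ : ∀ i, θ i ∈ Set.Ioo 0 Real.pi)
    (hcos : ∀ i, 2 * Real.cos (θ i) = 2 - ε ^ 2 * ν i ^ 2 / r ^ 2) {y : ℝ → Fin d → ℂ}
    (hy : ∀ i, IsSinusoid (θ i) (Set.Icc 0 m) (fun s => S.mulVec (y (a + s * (2 * ε))) i)) :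
    IsPseudoPeriodicDEL P Q a b r ε y := by
  classical
  choose C E hCE using hy
  beta_reduce at hCE
  have hε' : (ε : ℂ) ≠ 0 := by exact_mod_cast hε.ne'
  constructor
  -- `C cos + E sin` splits into exponentials with amplitudes `(C ∓ iE)/2` at `±θ`. Several modes
  -- may share a phase, so the amplitude at `φ` sums over all modes.
  · refine ⟨Finset.univ.image θ ∪ Finset.univ.image (fun i => -θ i),
      fun φ => ∑ i, (((if φ = θ i then (C i - Complex.I * E i) / 2 else 0) +
        (if φ = -θ i then (C i + Complex.I * E i) / 2 else 0) : ℂ)) • T.mulVec (Pi.single i 1),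
      ?_, ?_⟩
    · intro φ hφ
      rcases Finset.mem_union.1 hφ with hφ | hφ
      · obtain ⟨i, -, rfl⟩ := Finset.mem_image.1 hφ
        exact ⟨⟨by linarith [(hθ i).1, Real.pi_pos], (hθ i).2.le⟩,
          h.exp_mem_spectrum_companion i (hcos i)⟩
      · obtain ⟨i, -, rfl⟩ := Finset.mem_image.1 hφ
        exact ⟨⟨by linarith [(hθ i).2], by linarith [(hθ i).1, Real.pi_pos]⟩,
          h.exp_mem_spectrum_companion i (by rw [Real.cos_neg, hcos i])⟩
    · intro t ht
      obtain ⟨s, hs, rfl⟩ : ∃ s ∈ Set.Icc 0 m, t = a + s * (2 * ε) := by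
        refine ⟨(t - a) / (2 * ε), ⟨div_nonneg (by linarith [ht.1]) (by linarith), ?_⟩, ?_⟩
        · rw [div_le_iff₀ (by linarith)]; linarith [ht.2]
        · field_simp; ring
      have hs' : (((a + s * (2 * ε) : ℝ) : ℂ) - a) / (2 * ε) = s := by
        push_cast; field_simp; ring
      rw [hs']
      apply h.modes_injective
      intro i
      rw [hCE i s hs, Matrix.mulVec_sum, Finset.sum_apply]
      have hsum : ∀ φ : ℝ, S.mulVec (Complex.exp (Complex.I * φ * s) •
          ∑ i, (((if φ = θ i then (C i - Complex.I * E i) / 2 else 0) +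
          (if φ = -θ i then (C i + Complex.I * E i) / 2 else 0) : ℂ)) •
            T.mulVec (Pi.single i 1)) i =
          (if φ = θ i then Complex.exp (Complex.I * θ i * s) * ((C i - Complex.I * E i) / 2)
            else 0) +
          (if φ = -θ i then Complex.exp (-(Complex.I * θ i * s)) * ((C i + Complex.I * E i) / 2)
            else 0) := by
        intro φ
        rw [Matrix.mulVec_smul, Matrix.mulVec_sum, Pi.smul_apply, Finset.sum_apply,
          Finset.sum_eq_single i]
        · rw [Matrix.mulVec_smul, h.mulVec_mulVec', Pi.smul_apply, Pi.single_eq_same, smul_eq_mul,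
            smul_eq_mul, mul_one, mul_add]
          congr 1
          · split_ifs with h1
            · rw [h1]
            · simp
          · split_ifs with h1
            · rw [h1]; push_cast; ring_nf
            · simp
        · intro j _ hj
          rw [Matrix.mulVec_smul, h.mulVec_mulVec', Pi.smul_apply, Pi.single_eq_of_ne hj.symm,
            smul_zero]
        · simp
      rw [Finset.sum_congr rfl fun φ _ => hsum φ, Finset.sum_add_distrib, Finset.sum_ite_eq',
        Finset.sum_ite_eq', if_pos (by simp), if_pos (by simp)]
      have e1 : Complex.exp (Complex.I * θ i * s) =
          Real.cos (θ i * s) + Real.sin (θ i * s) * Complex.I := by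
        rw [Complex.ofReal_cos, Complex.ofReal_sin, ← Complex.exp_mul_I]
        congr 1; push_cast; ring
      have e2 : Complex.exp (-(Complex.I * θ i * s)) =
          Real.cos (θ i * s) - Real.sin (θ i * s) * Complex.I := by
        have := Complex.exp_mul_I (((-(θ i * s) : ℝ)) : ℂ)
        rw [← Complex.ofReal_cos, ← Complex.ofReal_sin, Real.cos_neg, Real.sin_neg] at this
        rw [show -(Complex.I * θ i * s) = ((-(θ i * s) : ℝ) : ℂ) * Complex.I by push_cast; ring,
          this]
        push_cast; ring
      rw [e1, e2]
      linear_combination (E i * Real.sin (θ i * s)) * Complex.I_sq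
  · intro t ht
    rw [h.delAt_interior_iff hr hε y ht]
    intro i
    obtain ⟨s, hs1, hs2, rfl⟩ : ∃ s, 1 ≤ s ∧ s ≤ m - 1 ∧ t = a + s * (2 * ε) := by
      refine ⟨(t - a) / (2 * ε), ?_, ?_, ?_⟩
      · rw [le_div_iff₀ (by linarith)]; linarith [ht.1]
      · rw [div_le_iff₀ (by linarith)]; linarith [ht.2]
      · field_simp; ring
    rw [show a + s * (2 * ε) + 2 * ε = a + (s + 1) * (2 * ε) by ring,
      show a + s * (2 * ε) - 2 * ε = a + (s - 1) * (2 * ε) by ring,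
      hCE i s ⟨by linarith, by linarith⟩, hCE i (s + 1) ⟨by linarith, by linarith⟩,
      hCE i (s - 1) ⟨by linarith, by linarith⟩, ← hcos]
    rw [mul_add, mul_sub, mul_one, Real.cos_add, Real.cos_sub, Real.sin_add, Real.sin_sub]
    push_cast
    ring

lemma IsModal.isSinusoid_of_isCELSolution (h : IsModal P Q T S ν) (hab : a < b)
    (hν : ∀ i, 0 < ν i) {da db : Fin d → ℂ} {z : ℝ → Fin d → ℂ}
    (hz : IsCELSolution P Q a b da db z) (i : Fin d) :
    IsSinusoid (ν i) (Set.Icc a b) (fun t => S.mulVec (z t) i) := by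
  obtain ⟨-, -, z₁, z₂, hz⟩ := hz
  have hlin : ∀ {f : ℝ → Fin d → ℂ} {f' : Fin d → ℂ} {t : ℝ},
      HasDerivWithinAt f f' (Set.Icc a b) t →
      HasDerivWithinAt (fun t => S.mulVec (f t) i) (S.mulVec f' i) (Set.Icc a b) t := by
    intro f f' t hf
    rw [hasDerivWithinAt_pi] at hf
    simp only [Matrix.mulVec, dotProduct]
    exact HasDerivWithinAt.fun_sum fun j _ => (hf j).const_mul _
  refine isSinusoid_of_oscillator hab (hν i).ne' (v₁ := fun t => S.mulVec (z₁ t) i)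
    (v₂ := fun t => S.mulVec (z₂ t) i) (fun t ht => hlin (hz t ht).1)
    (fun t ht => hlin (hz t ht).2.1) fun t ht => ?_
  have h1 := (hz t ht).2.2
  rw [← neg_one_smul ℂ] at h1
  have h2 := (h.eq_iff _ _ _).1 h1 i
  linear_combination -h2

/-- The solution of the classical boundary value problem, mode by mode. -/
noncomputable def celSolution (T S : Matrix (Fin d) (Fin d) ℂ) (ν : Fin d → ℝ) (a b : ℝ)
    (da db : Fin d → ℂ) (t : ℝ) : Fin d → ℂ :=
  T.mulVec fun i => sineInterp (ν i) a b (S.mulVec da i) (S.mulVec db i) t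

lemma IsModal.isCELSolution_celSolution (h : IsModal P Q T S ν)
    (hs : ∀ i, Real.sin (ν i * (b - a)) ≠ 0) (da db : Fin d → ℂ) :
    IsCELSolution P Q a b da db (celSolution T S ν a b da db) := by
  have hlin : ∀ {f : ℝ → Fin d → ℂ} {f' : Fin d → ℂ} {t : ℝ},
      (∀ i, HasDerivAt (fun t => f t i) (f' i) t) →
      HasDerivAt (fun t => T.mulVec (f t)) (T.mulVec f') t := by
    intro f f' t hf
    rw [hasDerivAt_pi]
    intro i
    simp only [Matrix.mulVec, dotProduct]
    exact HasDerivAt.fun_sum fun j _ => (hf j).const_mul _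
  refine ⟨?_, ?_,
    fun t => T.mulVec fun i => (-S.mulVec da i * Real.cos (ν i * (b - t)) +
      S.mulVec db i * Real.cos (ν i * (t - a))) * ν i / Real.sin (ν i * (b - a)),
    fun t => T.mulVec fun i =>
      -(ν i : ℂ) ^ 2 * sineInterp (ν i) a b (S.mulVec da i) (S.mulVec db i) t, fun t _ =>
    ⟨(hlin fun i => hasDerivAt_sineInterp _ _ _ _ _ _).hasDerivWithinAt,
      (hlin fun i => hasDerivAt_deriv_sineInterp _ _ _ _ _ _).hasDerivWithinAt, ?_⟩⟩
  · simp only [celSolution, sineInterp_left (hs _)]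
    exact h.mulVec_mulVec da
  · simp only [celSolution, sineInterp_right (hs _)]
    exact h.mulVec_mulVec db
  · rw [← neg_one_smul ℂ, h.eq_iff]
    intro i
    simp only [celSolution, h.mulVec_mulVec']
    ring

lemma IsModal.eqOn_celSolution (h : IsModal P Q T S ν) (hab : a < b) (hν : ∀ i, 0 < ν i)
    (hs : ∀ i, Real.sin (ν i * (b - a)) ≠ 0) {da db : Fin d → ℂ} {z : ℝ → Fin d → ℂ}
    (hz : IsCELSolution P Q a b da db z) :
    Set.EqOn z (celSolution T S ν a b da db) (Set.Icc a b) := by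
  intro t ht
  apply h.modes_injective
  intro i
  have h1 := (h.isSinusoid_of_isCELSolution hab hν hz i).eqOn_sineInterp
    (Set.left_mem_Icc.2 hab.le) (Set.right_mem_Icc.2 hab.le) (hs i) ht
  simp only [hz.1, hz.2.1] at h1
  rw [h1, celSolution, h.mulVec_mulVec']

/-- The modewise combination of sines with prescribed modes `α`, `β` after `p` and `q` double
steps of size `2ε`. -/
noncomputable def stepSolution (T : Matrix (Fin d) (Fin d) ℂ) (θ : Fin d → ℝ) (a ε p q : ℝ)
    (α β : Fin d → ℂ) (t : ℝ) : Fin d → ℂ :=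
  T.mulVec fun i => sineInterp (θ i) p q (α i) (β i) ((t - a) / (2 * ε))

lemma IsModal.mulVec_stepSolution (h : IsModal P Q T S ν) (hε : 0 < ε) (θ : Fin d → ℝ)
    (p q : ℝ) (α β : Fin d → ℂ) (s : ℝ) (i : Fin d) :
    S.mulVec (stepSolution T θ a ε p q α β (a + s * (2 * ε))) i =
      sineInterp (θ i) p q (α i) (β i) s := by
  rw [stepSolution, h.mulVec_mulVec', add_sub_cancel_left, mul_div_cancel_right₀ _ (by positivity)]

lemma IsModal.isPseudoPeriodicDEL_stepSolution (h : IsModal P Q T S ν) (hr : r ≠ 0)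
    (hε : 0 < ε) {m : ℝ} (hb : b = a + m * (2 * ε)) {θ : Fin d → ℝ}
    (hθ : ∀ i, θ i ∈ Set.Ioo 0 Real.pi)
    (hcos : ∀ i, 2 * Real.cos (θ i) = 2 - ε ^ 2 * ν i ^ 2 / r ^ 2) (p q : ℝ)
    (α β : Fin d → ℂ) : IsPseudoPeriodicDEL P Q a b r ε (stepSolution T θ a ε p q α β) := by
  refine h.isPseudoPeriodicDEL_of_isSinusoid hr hε hb hθ hcos fun i => ?_
  simp only [h.mulVec_stepSolution hε]
  exact isSinusoid_sineInterp _ _ _ _ _ _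

lemma IsModal.eqOn_stepSolution (h : IsModal P Q T S ν) (hr : r ≠ 0)
    (hε : 0 < ε) {m : ℝ} (hm : 2 < m) (hb : b = a + m * (2 * ε)) {θ : Fin d → ℝ}
    (hθ : ∀ i, θ i ∈ Set.Ioo 0 Real.pi)
    (hcos : ∀ i, 2 * Real.cos (θ i) = 2 - ε ^ 2 * ν i ^ 2 / r ^ 2) {p q : ℝ}
    (hp : p ∈ Set.Icc 0 m) (hq : q ∈ Set.Icc 0 m)
    (hs : ∀ i, Real.sin (θ i * (q - p)) ≠ 0) {α β : Fin d → ℂ} {y : ℝ → Fin d → ℂ}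
    (hy : IsPseudoPeriodicDEL P Q a b r ε y)
    (hα : ∀ i, S.mulVec (y (a + p * (2 * ε))) i = α i)
    (hβ : ∀ i, S.mulVec (y (a + q * (2 * ε))) i = β i) :
    Set.EqOn y (stepSolution T θ a ε p q α β) (Set.Icc a b) := by
  intro t ht
  obtain ⟨s, hs', rfl⟩ : ∃ s ∈ Set.Icc 0 m, t = a + s * (2 * ε) := by
    refine ⟨(t - a) / (2 * ε), ⟨div_nonneg (by linarith [ht.1]) (by linarith), ?_⟩, ?_⟩
    · rw [div_le_iff₀ (by linarith)]; linarith [ht.2]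
    · field_simp; ring
  apply h.modes_injective
  intro i
  have h1 := (h.isSinusoid_of_isPseudoPeriodicDEL hr hε hm hb hθ hcos hy i).eqOn_sineInterp
    hp hq (hs i) hs'
  simp only [hα, hβ] at h1
  rw [h1, h.mulVec_stepSolution hε]

/-- The forms `0 * (2 * ε)` and `m - 0` match the general boundary problem with offset `j = 0`. -/
lemma IsModal.isDiscreteSolution_iff (h : IsModal P Q T S ν) {m : ℝ}
    (hb : b = a + m * (2 * ε)) {da db : Fin d → ℂ} {y : ℝ → Fin d → ℂ} :
    IsDiscreteSolution P Q a b r ε da db y ↔ IsPseudoPeriodicDEL P Q a b r ε y ∧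
      (∀ i, S.mulVec (y (a + 0 * (2 * ε))) i = S.mulVec da i) ∧
      ∀ i, S.mulVec (y (a + (m - 0) * (2 * ε))) i = S.mulVec db i := by
  rw [zero_mul, add_zero, sub_zero, ← hb]
  exact and_congr_right fun _ => and_congr
    ⟨fun e i => by rw [e], h.modes_injective⟩ ⟨fun e i => by rw [e], h.modes_injective⟩

lemma IsModal.isDiscreteSolutionEndpoint_iff (h : IsModal P Q T S ν) (hr : r ≠ 0) (hε : 0 < ε)
    {m : ℝ} (hm : 2 < m) (hb : b = a + m * (2 * ε)) {da db : Fin d → ℂ} {y : ℝ → Fin d → ℂ} :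
    IsDiscreteSolutionEndpoint P Q a b r ε da db y ↔ IsPseudoPeriodicDEL P Q a b r ε y ∧
      (∀ i, S.mulVec (y (a + 1 * (2 * ε))) i =
        ((1 - ε ^ 2 * ν i ^ 2 / r ^ 2 : ℝ) : ℂ) * S.mulVec da i) ∧
      ∀ i, S.mulVec (y (a + (m - 1) * (2 * ε))) i =
        ((1 - ε ^ 2 * ν i ^ 2 / r ^ 2 : ℝ) : ℂ) * S.mulVec db i := by
  have hb' : a + (m - 1) * (2 * ε) = b - 2 * ε := by rw [hb]; ring
  have hlen : a + 2 * ε < b - 2 * ε := by rw [hb]; nlinarith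
  rw [one_mul, hb']
  refine and_congr_right fun _ => ⟨?_, ?_⟩
  · rintro ⟨x, hxa, hxb, hda, hdb, hxy⟩
    rw [h.delAt_left_iff hr hε (by linarith), hxa, hxy ⟨le_rfl, hlen.le⟩] at hda
    rw [h.delAt_right_iff hr hε (by linarith), hxb, hxy ⟨hlen.le, le_rfl⟩] at hdb
    exact ⟨hda, hdb⟩
  · rintro ⟨ha, hb⟩
    -- The endpoint equations see `x` only at `a`, `a + 2ε`, `b - 2ε` and `b`, so it suffices to
    -- change `y` at `a` and `b`.
    refine ⟨fun t => if t = a then da else if t = b then db else y t, ?_, ?_, ?_, ?_, ?_⟩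
    · simp
    · simp [show b ≠ a by linarith]
    · rw [h.delAt_left_iff hr hε (by linarith)]
      simpa [hε.ne', show a + 2 * ε ≠ b by linarith] using ha
    · rw [h.delAt_right_iff hr hε (by linarith)]
      simpa [hε.ne', show b - 2 * ε ≠ a by linarith, show b ≠ a by linarith] using hb
    · intro t ht
      simp [show t ≠ a by linarith [ht.1], show t ≠ b by linarith [ht.2]]

end Dynamics

/-! ### Limits of the discrete modes. -/

open Filter Topology

/-- With `2k` steps the discrete modes converge when the phases do. -/
lemma tendstoUniformlyOn_sineInterp {a b φ j : ℝ} (hab : a < b) (hφ : Real.sin φ ≠ 0)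
    {θ : ℕ → ℝ} {α β : ℕ → ℂ} {α₀ β₀ : ℂ} (hθ : Tendsto θ atTop (𝓝 0))
    (hkθ : Tendsto (fun k : ℕ => k * θ k) atTop (𝓝 φ)) (hα : Tendsto α atTop (𝓝 α₀))
    (hβ : Tendsto β atTop (𝓝 β₀)) :
    TendstoUniformlyOn (fun (k : ℕ) t => sineInterp (θ k) j (((2 * k : ℕ) : ℝ) / 2 - j) (α k) (β k)
        ((t - a) / (2 * ((b - a) / (2 * k : ℕ)))))
      (fun t => sineInterp (φ / (b - a)) a b α₀ β₀ t) atTop (Set.Icc a b) := by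
  have hba : b - a ≠ 0 := (sub_pos.2 hab).ne'
  -- In rescaled time `(t-a)/(b-a)` the discrete modes and their limit are one formula with
  -- parameters `(kθ, jθ, α, β)`. It is jointly continuous near the limit parameters, and
  -- compactness of `[a,b]` makes the convergence uniform.
  set G : ℝ × ℝ × ℂ × ℂ → Set.Icc a b → ℂ := fun p t =>
    (p.2.2.1 * Real.sin (p.1 - p.2.1 - p.1 * ((t - a) / (b - a))) +
      p.2.2.2 * Real.sin (p.1 * ((t - a) / (b - a)) - p.2.1)) / Real.sin (p.1 - 2 * p.2.1) with hG
  have hU : {p : ℝ × ℝ × ℂ × ℂ | Real.sin (p.1 - 2 * p.2.1) ≠ 0} ∈ 𝓝 (φ, 0, α₀, β₀) := by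
    refine IsOpen.mem_nhds (isOpen_ne_fun (by fun_prop) continuous_const) ?_
    simpa using hφ
  have hcont : ContinuousOn (Function.uncurry G)
      ({p : ℝ × ℝ × ℂ × ℂ | Real.sin (p.1 - 2 * p.2.1) ≠ 0} ×ˢ Set.univ) := by
    refine ContinuousOn.div (by fun_prop) (by fun_prop) ?_
    rintro ⟨p, t⟩ ⟨hp, -⟩
    exact_mod_cast hp
  have hunif := ContinuousOn.tendstoUniformly (f := G) hU hcont
  have hj : Tendsto (fun k => j * θ k) atTop (𝓝 0) := by simpa using hθ.const_mul j
  have hp : Tendsto (fun k : ℕ => ((k * θ k, j * θ k, α k, β k) : ℝ × ℝ × ℂ × ℂ)) atTop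
      (𝓝 (φ, 0, α₀, β₀)) :=
    hkθ.prodMk_nhds (hj.prodMk_nhds (hα.prodMk_nhds hβ))
  rw [tendstoUniformlyOn_iff_tendstoUniformly_comp_coe]
  have h1 : TendstoUniformly (fun k : ℕ => G (k * θ k, j * θ k, α k, β k)) (G (φ, 0, α₀, β₀))
      atTop := fun u hu => hp.eventually (hunif u hu)
  convert h1 using 1
  · funext k t
    have hs : ((t : ℝ) - a) / (2 * ((b - a) / (2 * k : ℕ))) = k * ((t - a) / (b - a)) := by
      -- At `k = 0` both sides are `0` by the convention for division by zero.
      rcases eq_or_ne k 0 with rfl | hk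
      · simp
      · have : (k : ℝ) ≠ 0 := by exact_mod_cast hk
        push_cast
        field_simp
    have hk2 : ((2 * k : ℕ) : ℝ) / 2 = k := by push_cast; ring
    simp only [hG, sineInterp, hs, hk2]
    congr 4
    all_goals ring_nf
  · funext t
    simp only [hG, Function.comp, sineInterp]
    rw [show φ / (b - a) * (b - t) = φ - 0 - φ * ((t - a) / (b - a)) by field_simp; ring,
      show φ / (b - a) * (t - a) = φ * ((t - a) / (b - a)) - 0 by field_simp; ring,
      show φ / (b - a) * (b - a) = φ - 2 * 0 by field_simp; ring]

/-- The limits of the discrete modes have frequency `φ`, so they are the classical modes only if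
`φ` is the classical frequency. -/
lemma eq_of_tendsto_sineInterp {a b φ ψ j : ℝ} (hab : a < b) (hφ : 0 < φ) (hψ : 0 < ψ)
    (hs : Real.sin (ψ * (b - a)) ≠ 0) {θ : ℕ → ℝ} {α : ℕ → ℂ} (hθ : Tendsto θ atTop (𝓝 0))
    (hkθ : Tendsto (fun k : ℕ => k * θ k) atTop (𝓝 φ)) (hα : Tendsto α atTop (𝓝 1))
    (hne : ∀ᶠ k : ℕ in atTop, Real.sin (θ k * (k - j - j)) ≠ 0)
    (h : ∀ t ∈ Set.Icc a b, Tendsto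
      (fun k : ℕ => sineInterp (θ k) j (((2 * k : ℕ) : ℝ) / 2 - j) (α k) 0
        ((t - a) / (2 * ((b - a) / (2 * k : ℕ))))) atTop (𝓝 (sineInterp ψ a b 1 0 t))) :
    φ = ψ * (b - a) := by
  have hba : 0 < b - a := sub_pos.2 hab
  refine eq_of_sin_proportional hφ (by positivity) hs fun w hw => ?_
  set t := b - w * (b - a) with ht
  have htm : t ∈ Set.Icc a b := ⟨by rw [ht]; nlinarith [hw.2], by rw [ht]; nlinarith [hw.1]⟩
  -- Multiplying by the denominator before passing to the limit avoids dividing by `sin φ`, which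
  -- may vanish.
  have hL : Tendsto (fun k : ℕ => sineInterp (θ k) j (((2 * k : ℕ) : ℝ) / 2 - j) (α k) 0
        ((t - a) / (2 * ((b - a) / (2 * k : ℕ)))) * (Real.sin (k * θ k - 2 * (j * θ k)) : ℂ))
      atTop (𝓝 (sineInterp ψ a b 1 0 t * (Real.sin (φ - 2 * (j * 0)) : ℂ))) :=
    (h t htm).mul ((Complex.continuous_ofReal.tendsto _).comp
      ((Real.continuous_sin.tendsto _).comp (hkθ.sub ((hθ.const_mul j).const_mul 2))))
  have hR : Tendsto (fun k : ℕ => α k * (Real.sin (k * θ k * w - j * θ k) : ℂ)) atTop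
      (𝓝 (1 * (Real.sin (φ * w - j * 0) : ℂ))) :=
    hα.mul ((Complex.continuous_ofReal.tendsto _).comp
      ((Real.continuous_sin.tendsto _).comp ((hkθ.mul_const w).sub (hθ.const_mul j))))
  have heq := tendsto_nhds_unique (hR.congr' ?_) hL
  · have hsC : (Real.sin (ψ * (b - a)) : ℂ) ≠ 0 := by exact_mod_cast hs
    rw [sineInterp, ht] at heq
    simp only [mul_zero, sub_zero, one_mul, zero_mul, add_zero, sub_sub_cancel] at heq
    rw [div_mul_eq_mul_div, eq_div_iff hsC] at heq
    have := Complex.ofReal_injective (by push_cast at heq ⊢; exact heq :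
      ((Real.sin (φ * w) * Real.sin (ψ * (b - a)) : ℝ) : ℂ) =
        ((Real.sin (ψ * (w * (b - a))) * Real.sin φ : ℝ) : ℂ))
    rw [this, mul_comm (Real.sin φ)]
    congr 2
    ring
  · filter_upwards [hne, eventually_gt_atTop 0] with k hk hk0
    have hk' : (k : ℝ) ≠ 0 := by exact_mod_cast hk0.ne'
    have hk2 : ((2 * k : ℕ) : ℝ) / 2 = k := by push_cast; ring
    have e : (t - a) / (2 * ((b - a) / (2 * k : ℕ))) = k * (1 - w) := by
      rw [ht]
      push_cast
      field_simp
      ring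
    have hkC : (Real.sin (k * θ k - 2 * (j * θ k)) : ℂ) ≠ 0 := by
      rw [show k * θ k - 2 * (j * θ k) = θ k * (k - j - j) by ring]
      exact_mod_cast hk
    rw [sineInterp, hk2, e, show θ k * (k - j - j) = k * θ k - 2 * (j * θ k) by ring,
      div_mul_cancel₀ _ hkC, zero_mul, add_zero]
    congr 3
    ring

/-! ### The discrete boundary problem with general offset. -/

section Boundary

variable {d : ℕ} {P Q : Matrix (Fin d) (Fin d) ℝ} {T S : Matrix (Fin d) (Fin d) ℂ}
  {ν : Fin d → ℝ} {a b r : ℝ}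

/-- Well-posedness and convergence for a discrete boundary value problem `Sol` that prescribes the
modes of a pseudo-periodic solution at `a + 2jε` and `b - 2jε` as `σ` times those of the data. -/
theorem IsModal.discrete_boundary_problem (h : IsModal P Q T S ν) (hd : 1 ≤ d) (hab : a < b)
    (hr : r ≠ 0) (hν : ∀ i, 0 < ν i) (hs : ∀ i, Real.sin (ν i * (b - a)) ≠ 0)
    {c : Fin d → ℝ} (hc : ∀ i, c i = (b - a) * ν i / (2 * |r|))
    (Sol : ℕ → (Fin d → ℂ) → (Fin d → ℂ) → (ℝ → Fin d → ℂ) → Prop) (adm : ℕ → Prop)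
    (hadm : ∀ M, adm M → 6 ≤ M ∧ ∀ i, c i < M)
    (σ : ℕ → Fin d → ℂ) (hσ : ∀ i, Tendsto (fun k : ℕ => σ (2 * k) i) atTop (𝓝 1)) {j : ℝ}
    (hj : j ∈ Set.Icc (0 : ℝ) 1)
    (hsin : ∀ M, adm M → ∀ i, Real.sin (phase (c i) M * (M / 2 - j - j)) ≠ 0)
    (hev : ∀ᶠ k : ℕ in atTop, adm (2 * k))
    (hSol : ∀ M, adm M → ∀ da db y, Sol M da db y ↔
      IsPseudoPeriodicDEL P Q a b r ((b - a) / M) y ∧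
      (∀ i, S.mulVec (y (a + j * (2 * ((b - a) / M)))) i = σ M i * S.mulVec da i) ∧
      ∀ i, S.mulVec (y (a + (M / 2 - j) * (2 * ((b - a) / M)))) i = σ M i * S.mulVec db i) :
    ∃ y : ℕ → (Fin d → ℂ) → (Fin d → ℂ) → ℝ → Fin d → ℂ,
      (∀ M, adm M → ∀ da db, Sol M da db (y M da db) ∧
        ∀ y', Sol M da db y' → Set.EqOn y' (y M da db) (Set.Icc a b)) ∧
      ((r = 1 / 2 ∨ r = -1 / 2) ↔ ∀ da db, TendstoUniformlyOn (fun k : ℕ => y (2 * k) da db)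
        (celSolution T S ν a b da db) atTop (Set.Icc a b)) := by
  have hba : 0 < b - a := sub_pos.2 hab
  have hr' : 0 < |r| := abs_pos.2 hr
  have hc0 : ∀ i, 0 < c i := fun i => by
    rw [hc]; exact div_pos (mul_pos hba (hν i)) (by positivity)
  refine ⟨fun M da db => stepSolution T (fun i => phase (c i) M) a ((b - a) / M) j (M / 2 - j)
    (fun i => σ M i * S.mulVec da i) (fun i => σ M i * S.mulVec db i), ?_, ?_⟩
  · intro M hM da db
    have hM6 : (6 : ℝ) ≤ M := by exact_mod_cast (hadm M hM).1
    have hM0 : (0 : ℝ) < M := by linarith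
    have hε : 0 < (b - a) / M := by positivity
    have hb : b = a + (M / 2 : ℝ) * (2 * ((b - a) / M)) := by field_simp; ring
    have hθ : ∀ i, phase (c i) M ∈ Set.Ioo 0 Real.pi := fun i =>
      phase_mem_Ioo (hc0 i) ((hadm M hM).2 i)
    have hcos : ∀ i, 2 * Real.cos (phase (c i) M) =
        2 - ((b - a) / M) ^ 2 * ν i ^ 2 / r ^ 2 := by
      intro i
      rw [cos_phase (hc0 i) ((hadm M hM).2 i), hc, ← sq_abs r]
      field_simp
    refine ⟨(hSol M hM da db _).2 ⟨h.isPseudoPeriodicDEL_stepSolution hr hε hb hθ hcos _ _ _ _,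
      fun i => ?_, fun i => ?_⟩, fun y' hy' => ?_⟩
    · rw [h.mulVec_stepSolution hε, sineInterp_left (hsin M hM i)]
    · rw [h.mulVec_stepSolution hε, sineInterp_right (hsin M hM i)]
    · obtain ⟨h1, h2, h3⟩ := (hSol M hM da db y').1 hy'
      exact h.eqOn_stepSolution hr hε (by linarith) hb hθ hcos
        ⟨hj.1, by linarith [hj.2]⟩ ⟨by linarith [hj.2], by linarith [hj.1]⟩ (hsin M hM) h1 h2 h3
  · constructor
    · intro hr2 da db
      have hr2' : |r| = 1 / 2 := by
        rcases hr2 with rfl | rfl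
        · exact abs_of_pos (by norm_num)
        · rw [neg_div, abs_neg]; exact abs_of_pos (by norm_num)
      -- This is where `|r| = 1/2` enters: the limit of `kθ` is the classical frequency times `b -
      -- a`.
      have hcν : ∀ i, c i = ν i * (b - a) := fun i => by rw [hc, hr2']; ring
      have hmodes : TendstoUniformlyOn
          (fun (k : ℕ) t (i : Fin d) => sineInterp (phase (c i) (2 * k)) j
            (((2 * k : ℕ) : ℝ) / 2 - j) (σ (2 * k) i * S.mulVec da i)
            (σ (2 * k) i * S.mulVec db i) ((t - a) / (2 * ((b - a) / (2 * k : ℕ)))))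
          (fun t i => sineInterp (ν i) a b (S.mulVec da i) (S.mulVec db i) t) atTop
          (Set.Icc a b) := by
        rw [Metric.tendstoUniformlyOn_iff]
        intro η hη
        simp only [dist_pi_lt_iff hη]
        suffices hi : ∀ i, ∀ᶠ k : ℕ in atTop, ∀ t ∈ Set.Icc a b,
            dist (sineInterp (ν i) a b (S.mulVec da i) (S.mulVec db i) t)
              (sineInterp (phase (c i) (2 * k)) j (((2 * k : ℕ) : ℝ) / 2 - j)
              (σ (2 * k) i * S.mulVec da i) (σ (2 * k) i * S.mulVec db i)
              ((t - a) / (2 * ((b - a) / (2 * k : ℕ))))) < η by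
          filter_upwards [eventually_all.2 hi] with k hk t ht i using hk i t ht
        intro i
        refine Metric.tendstoUniformlyOn_iff.1 ?_ η hη
        have := tendstoUniformlyOn_sineInterp (j := j) hab (by rw [hcν]; exact hs i)
          (tendsto_phase_zero (c i)) (tendsto_mul_phase (c i))
          (by simpa using (hσ i).mul_const (S.mulVec da i))
          (by simpa using (hσ i).mul_const (S.mulVec db i))
        rwa [show c i / (b - a) = ν i by rw [hcν, mul_div_cancel_right₀ _ hba.ne']] at this
      exact (LinearMap.toContinuousLinearMap T.mulVecLin).uniformContinuous.comp_tendstoUniformlyOn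
        hmodes
    · intro hconv
      -- A single mode suffices for the converse; the data `T e_i` at `a` and `0` at `b` isolate it.
      set i : Fin d := ⟨0, hd⟩
      have hlim : ∀ t ∈ Set.Icc a b, Tendsto
          (fun k : ℕ => sineInterp (phase (c i) (2 * k)) j (((2 * k : ℕ) : ℝ) / 2 - j)
            (σ (2 * k) i) 0 ((t - a) / (2 * ((b - a) / (2 * k : ℕ))))) atTop
          (𝓝 (sineInterp (ν i) a b 1 0 t)) := by
        intro t ht
        have h1 := (hconv (T.mulVec (Pi.single i 1)) 0).tendsto_at ht
        have h2 := ((LinearMap.toContinuousLinearMap S.mulVecLin).continuous.tendsto _).comp h1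
        have h3 := tendsto_pi_nhds.1 h2 i
        simp only [Function.comp_def, celSolution, stepSolution,
          LinearMap.coe_toContinuousLinearMap', Matrix.mulVecLin_apply, h.mulVec_mulVec',
          Pi.single_eq_same, Matrix.mulVec_zero, Pi.zero_apply, mul_one, mul_zero] at h3
        exact h3
      have hne : ∀ᶠ k : ℕ in atTop,
          Real.sin (phase (c i) (2 * k) * ((k : ℝ) - j - j)) ≠ 0 := by
        filter_upwards [hev] with k hk
        have := hsin _ hk i
        rwa [show ((2 * k : ℕ) : ℝ) / 2 = k by push_cast; ring] at this
      have hci := eq_of_tendsto_sineInterp hab (hc0 i) (hν i) (hs i) (tendsto_phase_zero (c i))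
        (tendsto_mul_phase (c i)) (hσ i) hne hlim
      have hr2 : |r| = 1 / 2 := by
        rw [hc, div_eq_iff (by positivity)] at hci
        have : ν i * (b - a) * (2 * |r| - 1) = 0 := by linear_combination -hci
        have := (mul_eq_zero.1 this).resolve_left (mul_pos (hν i) hba).ne'
        linarith
      rcases (abs_eq (by norm_num)).1 hr2 with h1 | h1
      · exact Or.inl h1
      · exact Or.inr (by rw [h1]; norm_num)

end Boundary

/-! ### Non-resonance and the main theorem. -/

/-- This is the second non-resonance requirement at `n = M`: the argument of the arccosine is `1 - 2
(c/M)²` with `c = (b-a)|ω|/(2|r|)`, and `c < M` puts it in `[-1, 1]`. -/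
lemma NonResonant.irrational_phase {d : ℕ} {Ω : Matrix (Fin d) (Fin d) ℝ} {a b r : ℝ}
    (hres : NonResonant Ω a b r) (hr : r ≠ 0) {ω : ℝ} (hω : ω ∈ spectrum ℝ Ω) {M : ℕ}
    (hab : a < b) (hM : (b - a) * |ω| / (2 * |r|) < M) :
    Irrational (phase ((b - a) * |ω| / (2 * |r|)) M / Real.pi) := by
  have hr' : 0 < |r| := abs_pos.2 hr
  have hba : 0 < b - a := sub_pos.2 hab
  have hc0 : 0 ≤ (b - a) * |ω| / (2 * |r|) := by positivity
  have hM0 : (0 : ℝ) < M := hc0.trans_lt hM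
  set y := (b - a) * |ω| / (2 * |r|) / M with hy
  have hy0 : 0 ≤ y := by positivity
  have hy1 : y ≤ 1 := (div_le_one hM0).2 hM.le
  have e : 1 - (b - a) ^ 2 * ω ^ 2 / (2 * r ^ 2 * (M : ℝ) ^ 2) = 1 - 2 * y ^ 2 := by
    rw [hy, ← sq_abs r, ← sq_abs ω]
    field_simp
  have h1 := (hres ω hω).2 M (by exact_mod_cast hM0)
  rw [e, arccos_one_sub_two_mul_sq hy0 hy1] at h1
  exact h1 ⟨by nlinarith, by nlinarith⟩

end DiscreteEL

open DiscreteEL Filter Topology in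
theorem mainTheorem1 (d : ℕ) (hd : 1 ≤ d) (a b : ℝ) (hab : a < b) (r : ℝ) (hr : r ≠ 0)
    (P Q Ω : Matrix (Fin d) (Fin d) ℝ) (hPsymm : P.IsSymm) (hQsymm : Q.IsSymm)
    (hP : IsUnit P.det) (hQ : IsUnit Q.det) (hΩ : -(P⁻¹ * Q) = Ω ^ 2)
    (hdiag : DiscreteEL.IsDiagonalizable Ω) (hres : DiscreteEL.NonResonant Ω a b r) :
    ∃ z : (Fin d → ℂ) → (Fin d → ℂ) → ℝ → Fin d → ℂ,
      (∀ da db : Fin d → ℂ,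
        DiscreteEL.IsCELSolution P Q a b da db (z da db) ∧
        ∀ z' : ℝ → Fin d → ℂ, DiscreteEL.IsCELSolution P Q a b da db z' →
          Set.EqOn z' (z da db) (Set.Icc a b)) ∧
      (∃ y : ℕ → (Fin d → ℂ) → (Fin d → ℂ) → ℝ → Fin d → ℂ,
        (∀ M : ℕ, DiscreteEL.Admissible Ω a b r M → ∀ da db : Fin d → ℂ,
          DiscreteEL.IsDiscreteSolution P Q a b r ((b - a) / M) da db (y M da db) ∧
          ∀ y' : ℝ → Fin d → ℂ,
            DiscreteEL.IsDiscreteSolution P Q a b r ((b - a) / M) da db y' →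
            Set.EqOn y' (y M da db) (Set.Icc a b)) ∧
        ((r = 1 / 2 ∨ r = -1 / 2) ↔ ∀ da db : Fin d → ℂ,
          TendstoUniformlyOn (fun k : ℕ => y (2 * k) da db) (z da db) Filter.atTop
            (Set.Icc a b))) ∧
      (∃ y : ℕ → (Fin d → ℂ) → (Fin d → ℂ) → ℝ → Fin d → ℂ,
        (∀ M : ℕ, DiscreteEL.Admissible Ω a b r M → ∀ da db : Fin d → ℂ,
          DiscreteEL.IsDiscreteSolutionEndpoint P Q a b r ((b - a) / M) da db (y M da db) ∧
          ∀ y' : ℝ → Fin d → ℂ,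
            DiscreteEL.IsDiscreteSolutionEndpoint P Q a b r ((b - a) / M) da db y' →
            Set.EqOn y' (y M da db) (Set.Icc a b)) ∧
        ((r = 1 / 2 ∨ r = -1 / 2) ↔ ∀ da db : Fin d → ℂ,
          TendstoUniformlyOn (fun k : ℕ => y (2 * k) da db) (z da db) Filter.atTop
            (Set.Icc a b))) := by
  obtain ⟨T, S, D, h, hD⟩ := exists_isModal hP hΩ hdiag
  have hba : 0 < b - a := sub_pos.2 hab
  have hr' : 0 < |r| := abs_pos.2 hr
  -- A zero eigenvalue would make `(b-a)ω/π` rational.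
  have hν : ∀ i, 0 < |D i| := by
    intro i
    rw [abs_pos]
    intro h0
    apply (hres _ (hD i)).1
    rw [h0]
    exact ⟨0, by simp⟩
  have hs : ∀ i, Real.sin (|D i| * (b - a)) ≠ 0 := by
    intro i
    have h1 := sin_nat_mul_ne_zero (hres _ (hD i)).1 one_ne_zero
    rw [Nat.cast_one, mul_one, mul_comm] at h1
    rcases abs_choice (D i) with h2 | h2
    · rwa [h2]
    · rwa [h2, neg_mul, Real.sin_neg, neg_ne_zero]
  set c : Fin d → ℝ := fun i => (b - a) * |D i| / (2 * |r|) with hc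
  have hcM : ∀ M, Admissible Ω a b r M → ∀ i, c i < M := by
    intro M hM i
    have hM0 : (0 : ℝ) < M := by exact_mod_cast (show 0 < M by have := hM.2.1; omega)
    have h1 := hM.2.2 _ (hD i)
    rw [hc, div_lt_iff₀ (by positivity)]
    rw [div_mul_eq_mul_div, div_lt_iff₀ hM0] at h1
    linarith
  -- `M = 2k` with `k ≥ 3`, so `M/2 - 2j` is a positive integer even for `j = 1`.
  have hsin : ∀ M, Admissible Ω a b r M → ∀ (j : ℕ), j ≤ 1 → ∀ i,
      Real.sin (phase (c i) M * (M / 2 - j - j)) ≠ 0 := by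
    intro M hM j hj i
    obtain ⟨k, hk⟩ := hM.1
    have hM6 := hM.2.1
    have h1 := sin_nat_mul_ne_zero (n := k - j - j)
      (hres.irrational_phase hr (hD i) hab (hcM M hM i)) (by omega)
    rw [Nat.cast_sub (by omega), Nat.cast_sub (by omega)] at h1
    rwa [show (M : ℝ) / 2 = k by rw [hk]; push_cast; ring]
  -- The spectrum is finite, so the oscillation bounds hold simultaneously for large `k`.
  have hev : ∀ᶠ k : ℕ in atTop, Admissible Ω a b r (2 * k) := by
    have hfin : (spectrum ℝ Ω).Finite := Matrix.finite_spectrum Ω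
    have h1 : ∀ ω ∈ spectrum ℝ Ω, ∀ᶠ k : ℕ in atTop,
        (b - a) / ((2 * k : ℕ) : ℝ) * |ω| < 2 * |r| := by
      intro ω _
      have ht : Tendsto (fun k : ℕ => (b - a) / ((2 * k : ℕ) : ℝ) * |ω|) atTop (𝓝 (0 * |ω|)) :=
        ((tendsto_const_div_atTop_nhds_zero_nat (b - a)).comp
          (tendsto_id.const_mul_atTop' two_pos)).mul_const _
      rw [zero_mul] at ht
      exact ht.eventually_lt_const (by positivity)
    filter_upwards [hfin.eventually_all.2 h1, eventually_ge_atTop 3] with k hk hk3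
    exact ⟨even_two_mul k, by omega, hk⟩
  have hM : ∀ M, Admissible Ω a b r M → 0 < (b - a) / (M : ℝ) ∧ (2 : ℝ) < M / 2 ∧
      b = a + (M / 2 : ℝ) * (2 * ((b - a) / M)) := by
    intro M hM
    have hM6 : (6 : ℝ) ≤ M := by exact_mod_cast hM.2.1
    exact ⟨by positivity, by linarith, by field_simp; ring⟩
  refine ⟨celSolution T S (fun i => |D i|) a b, fun da db =>
    ⟨h.isCELSolution_celSolution hs da db, fun z' hz' => h.eqOn_celSolution hab hν hs hz'⟩, ?_, ?_⟩
  · refine h.discrete_boundary_problem hd hab hr hν hs (fun i => rfl)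
      (fun M => IsDiscreteSolution P Q a b r ((b - a) / M)) (Admissible Ω a b r)
      (fun M hM => ⟨hM.2.1, hcM M hM⟩) (fun _ _ => 1) (fun _ => tendsto_const_nhds) (j := 0)
      (by simp) (fun M hM i => by simpa using hsin M hM 0 zero_le_one i) hev ?_
    intro M hMa da db y
    simp only [one_mul]
    exact h.isDiscreteSolution_iff (hM M hMa).2.2
  · refine h.discrete_boundary_problem hd hab hr hν hs (fun i => rfl)
      (fun M => IsDiscreteSolutionEndpoint P Q a b r ((b - a) / M)) (Admissible Ω a b r)
      (fun M hM => ⟨hM.2.1, hcM M hM⟩)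
      -- The factor forced by the equation at the endpoints; it tends to `1` as `ε → 0`.
      (fun M i => ((1 - ((b - a) / M) ^ 2 * |D i| ^ 2 / r ^ 2 : ℝ) : ℂ)) (fun i => ?_) (j := 1)
      (by simp) (fun M hM i => by simpa using hsin M hM 1 le_rfl i) hev ?_
    · have ht : Tendsto (fun k : ℕ => (b - a) / ((2 * k : ℕ) : ℝ)) atTop (𝓝 0) :=
        (tendsto_const_div_atTop_nhds_zero_nat (b - a)).comp (tendsto_id.const_mul_atTop' two_pos)
      have ht2 := ((((ht.pow 2).mul_const (|D i| ^ 2)).div_const (r ^ 2)).const_sub 1).ofReal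
      simpa using ht2
    · intro M hMa da db y
      exact h.isDiscreteSolutionEndpoint_iff hr (hM M hMa).1 (hM M hMa).2.1 (hM M hMa).2.2
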